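/- Let $\mathbb F$ be any field and let $V$ be an $\mathbb F$-vector space of finite dimension $n\ge 4$ with an alternating bilinear form $\mathsf s$ of maximal rank (that is, $\dim\operatorname{Rad}(V)\le 1$), where $\operatorname{Rad}(U)=U\cap U^\perp$ for a subspace $U\le V$. If $n=5$, assume moreover that $|\mathbb F|\neq 2$. Let $G=\operatorname{Sp}(V)$ be the group of all linear automorphisms of $V$ preserving $\mathsf s$. Let $\Gamma$ be the pre-geometry over $I=\{1,\dots,n-1\}$ whose objects of type $i$ are the $i$-dimensional subspaces $U\le V$ with $U\cap\operatorname{Rad}(V)=0$ and $\dim\operatorname{Rad}(U)\le 1$; two distinct objects are incident if one of them, $X$, is contained in the other, $Y$, and $X\cap\operatorname{Rad}(Y)=0$. A flag is a set of pairwise incident objects, its type is the set of types of its elements, and a chamber is a flag of type $I$. Then $\Gamma$ is a geometry (every type occurs and every flag is contained in a chamber), $G$ acts flag-transitively on $\Gamma$ (by automorphisms, and for each $J\subseteq I$ transitively on the flags of type $J$), and for every chamber $C$ the group $G$ is the universal completion of the amalgam of its maximal parabolic subgroups with respect to $C$. In detail: for $J\subsetneq I$ let $P_J$ be the stabilizer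 in $G$ of the subflag of $C$ consisting of the elements whose type is not in $J$ (so the maximal parabolic subgroups are the $P_{I\setminus\{i\}}$, $i\in I$, and the other $P_J$ are their intersections), and let $\widehat G$ be the group generated by the disjoint union of the groups $P_J$, $J\subsetneq I$, subject to the multiplication relations of each $P_J$ and to the identification of $a\in P_J$ with $a\in P_K$ whenever $J\subset K\subsetneq I$. Then the inclusions $P_J\hookrightarrow G$ induce an isomorphism $\widehat G\cong G$. -/

import Mathlib

open Module

universe u v w

/-! ### Pre-geometries -/

/-- A pre-geometry over the type set `I` with collection of objects `O`. -/
structure PreGeometry (O : Type u) (I : Type v) where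
  /-- the type function -/
  typ : O → I
  /-- the incidence relation -/
  inc : O → O → Prop
  inc_refl : ∀ X, inc X X
  inc_symm : ∀ X Y, inc X Y → inc Y X
  eq_or_typ_ne : ∀ X Y, inc X Y → X = Y ∨ typ X ≠ typ Y

namespace PreGeometry

variable {O : Type u} {I : Type v} (Γ : PreGeometry O I)

/-- A flag is a (possibly empty) collection of pairwise incident objects. -/
def IsFlag (E : Set O) : Prop := ∀ X ∈ E, ∀ Y ∈ E, Γ.inc X Y

/-- The type of a set of objects, in particular of a flag. -/
def flagType (E : Set O) : Set I := Γ.typ '' E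

/-- A chamber is a flag of type `I`. -/
def IsChamber (C : Set O) : Prop := Γ.IsFlag C ∧ Γ.flagType C = Set.univ

/-- A pre-geometry is a geometry if every type occurs and every flag lies in a chamber. -/
def IsGeometry : Prop :=
  Set.range Γ.typ = Set.univ ∧
    ∀ E : Set O, Γ.IsFlag E → ∃ C : Set O, Γ.IsChamber C ∧ E ⊆ C

/-- `cotypeFlag C J` is the subflag of `C` of cotype `J`, i.e. of type `I \ J` if `C` is a
chamber. -/
def cotypeFlag (C : Set O) (J : Set I) : Set O := {X | X ∈ C ∧ Γ.typ X ∉ J}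

variable (G : Type w) [Group G] [MulAction G O]

/-- `G` acts by type and incidence preserving permutations of the objects. -/
def ActsByAutomorphisms : Prop :=
  (∀ (g : G) (X : O), Γ.typ (g • X) = Γ.typ X) ∧
    ∀ (g : G) (X Y : O), Γ.inc (g • X) (g • Y) ↔ Γ.inc X Y

/-- `G` acts by automorphisms, transitively on the flags of each type `J ⊆ I`. -/
def ActsFlagTransitively : Prop :=
  Γ.ActsByAutomorphisms G ∧
    ∀ (J : Set I) (E₁ E₂ : Set O), Γ.IsFlag E₁ → Γ.flagType E₁ = J →
      Γ.IsFlag E₂ → Γ.flagType E₂ = J → ∃ g : G, (fun X => g • X) '' E₁ = E₂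

/-- The standard parabolic subgroup `P_J` of `G` with respect to `C`: the (setwise) stabilizer
of the subflag of `C` of cotype `J`. -/
def parabolic (C : Set O) (J : Set I) : Subgroup G where
  carrier := {g | (fun X => g • X) '' Γ.cotypeFlag C J = Γ.cotypeFlag C J}
  one_mem' := by simp
  mul_mem' := by
    intro a b ha hb
    have hc : (fun X : O => (a * b) • X) = (fun X => a • X) ∘ (fun X => b • X) := by
      funext X; exact mul_smul a b X
    simp only [Set.mem_ofPred_eq] at ha hb ⊢
    rw [hc, Set.image_comp, hb, ha]
  inv_mem' := by
    intro a ha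
    simp only [Set.mem_ofPred_eq] at ha ⊢
    conv_lhs => rw [← ha]
    rw [← Set.image_comp]
    simp

end PreGeometry

/-! ### Amalgams and their universal completions -/

/-- An amalgam of groups over a partially ordered set. -/
structure Amalgam (B : Type v) [PartialOrder B] where
  /-- the groups of the amalgam -/
  grp : B → Type u
  [isGroup : ∀ β, Group (grp β)]
  /-- the connecting homomorphisms -/
  map : ∀ {β γ : B}, β < γ → grp β →* grp γ
  map_comp : ∀ {β γ δ : B} (h₁ : β < γ) (h₂ : γ < δ),
    (map h₂).comp (map h₁) = map (h₁.trans h₂)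

attribute [instance] Amalgam.isGroup

namespace Amalgam

variable {B : Type v} [PartialOrder B] (A : Amalgam.{u, v} B)

/-- The defining relators of the universal completion, on the letters `⟨β, a⟩`, `a ∈ A_β`:
the multiplication tables of all the `A_β`, and the identification of `a ∈ A_β` with its image
in `A_γ` for `β < γ`. -/
inductive Relator : FreeGroup (Σ β : B, A.grp β) → Prop
  | mul (β : B) (a b : A.grp β) :
      Relator (FreeGroup.of ⟨β, a⟩ * FreeGroup.of ⟨β, b⟩ * (FreeGroup.of ⟨β, a * b⟩)⁻¹)
  | glue (β γ : B) (h : β < γ) (a : A.grp β) :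
      Relator (FreeGroup.of ⟨β, a⟩ * (FreeGroup.of ⟨γ, A.map h a⟩)⁻¹)

/-- The universal completion (amalgamated sum) of an amalgam. -/
abbrev UniversalCompletion : Type (max u v) :=
  PresentedGroup {r : FreeGroup (Σ β : B, A.grp β) | A.Relator r}

/-- The canonical homomorphism from a group of the amalgam to the universal completion. -/
def toCompletion (β : B) : A.grp β →* A.UniversalCompletion :=
  MonoidHom.mk' (fun a => PresentedGroup.of ⟨β, a⟩) (by
    intro a b
    have h := PresentedGroup.one_of_mem
      (rels := {r : FreeGroup (Σ β : B, A.grp β) | A.Relator r}) (Relator.mul β a b)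
    rw [map_mul, map_mul, map_inv] at h
    exact (mul_inv_eq_one.mp h).symm)

end Amalgam

namespace PreGeometry

variable {O : Type u} {I : Type v} (Γ : PreGeometry O I) (G : Type w) [Group G] [MulAction G O]

theorem parabolic_mono_of_aut (hG : ∀ (g : G) (X : O), Γ.typ (g • X) = Γ.typ X)
    (C : Set O) {J K : Set I} (h : J ⊆ K) : Γ.parabolic G C J ≤ Γ.parabolic G C K := by
  intro g hg
  change (fun X => g • X) '' _ = _ at hg
  change (fun X => g • X) '' _ = _
  have key : Γ.cotypeFlag C K = {X ∈ Γ.cotypeFlag C J | Γ.typ X ∉ K} := by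
    ext X
    exact ⟨fun hX => ⟨⟨hX.1, fun hJ => hX.2 (h hJ)⟩, hX.2⟩, fun hX => ⟨hX.1.1, hX.2⟩⟩
  rw [key]
  ext Y
  constructor
  · rintro ⟨X, ⟨hX, hXK⟩, rfl⟩
    exact ⟨hg ▸ ⟨X, hX, rfl⟩, by simpa [hG] using hXK⟩
  · rintro ⟨hY, hYK⟩
    rw [← hg] at hY
    obtain ⟨X, hX, rfl⟩ := hY
    exact ⟨X, ⟨hX, by simpa [hG] using hYK⟩, rfl⟩

/-- The amalgam of the maximal parabolic subgroups of `G` with respect to the chamber `C`.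
The maximal parabolics are the `P_{I \ {i}}`; together with their intersections `P_J`, the groups
are the standard parabolics `P_J` for the proper subsets `J` of `I`, ordered by inclusion of
types, with the inclusion maps as connecting homomorphisms. -/
def maximalParabolicAmalgam (hG : Γ.ActsByAutomorphisms G) (C : Set O) :
    Amalgam.{w, v} {J : Set I // J ≠ Set.univ} where
  grp J := Γ.parabolic G C J.1
  map h := Subgroup.inclusion (Γ.parabolic_mono_of_aut G hG.1 C (le_of_lt h))
  map_comp _ _ := rfl

/-- `G` is the universal completion of the amalgam of its maximal parabolic subgroups with
respect to `C`: there is an isomorphism from the universal completion to `G` that restricts to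
the inclusion map of each group of the amalgam into `G`. -/
def IsCompletionOfMaximalParabolics (hG : Γ.ActsByAutomorphisms G) (C : Set O) : Prop :=
  ∃ e : (Γ.maximalParabolicAmalgam G hG C).UniversalCompletion ≃* G,
    ∀ (J : {J : Set I // J ≠ Set.univ}) (x : Γ.parabolic G C J.1),
      e ((Γ.maximalParabolicAmalgam G hG C).toCompletion J x) = (x : G)

end PreGeometry

/-! ### The symplectic group and the quasi Curtis-Tits-Phan geometry -/

section Symplectic

variable {F : Type u} {V : Type v} [Field F] [AddCommGroup V] [Module F V]
  (s : LinearMap.BilinForm F V)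

/-- The radical `U ∩ U^⊥` of a subspace `U`. -/
def formRad (U : Submodule F V) : Submodule F V := U ⊓ s.orthogonal U

/-- The group `Sp(V)` of all linear automorphisms of `V` preserving the form `s`. -/
def SpGroup : Subgroup (V ≃ₗ[F] V) where
  carrier := {g | ∀ x y, s (g x) (g y) = s x y}
  one_mem' := by intro x y; rfl
  mul_mem' := by
    intro a b ha hb x y
    exact (ha (b x) (b y)).trans (hb x y)
  inv_mem' := by
    intro a ha x y
    have h := ha (a⁻¹ x) (a⁻¹ y)
    have e : ∀ z, a (a⁻¹ z) = z := fun z => a.apply_symm_apply z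
    rw [e, e] at h
    exact h.symm

theorem formRad_map (g : SpGroup s) (U : Submodule F V) :
    formRad s (U.map (g : V ≃ₗ[F] V).toLinearMap) =
      (formRad s U).map (g : V ≃ₗ[F] V).toLinearMap := by
  ext x
  simp only [formRad, Submodule.mem_inf, LinearMap.BilinForm.mem_orthogonal_iff,
    Submodule.mem_map, LinearEquiv.coe_coe]
  constructor
  · rintro ⟨⟨y, hy, rfl⟩, h⟩
    refine ⟨y, ⟨hy, fun n hn => ?_⟩, rfl⟩
    rw [← g.2 n y]
    exact h _ ⟨n, hn, rfl⟩
  · rintro ⟨y, ⟨hy, h⟩, rfl⟩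
    refine ⟨⟨y, hy, rfl⟩, ?_⟩
    rintro _ ⟨n, hn, rfl⟩
    rw [g.2 n y]
    exact h n hn

/-- The objects of the quasi Curtis-Tits-Phan geometry: the nonzero proper subspaces `U` of `V`
with `U ∩ Rad(V) = 0` and `dim Rad(U) ≤ 1`. -/
def QCTPObject : Type v :=
  {U : Submodule F V // 1 ≤ finrank F U ∧ finrank F U < finrank F V ∧
    Disjoint U (formRad s ⊤) ∧ finrank F (formRad s U) ≤ 1}

/-- `X ⊆ Y - Rad(Y)`, i.e. `X ⊆ Y` and `X ∩ Rad(Y) = 0`. -/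
def liesIn (X Y : Submodule F V) : Prop := X ≤ Y ∧ Disjoint X (formRad s Y)

/-- The quasi Curtis-Tits-Phan geometry `Γ(V)` over `I = {1, …, n - 1}`, where `n = dim V`. The
type of an object is its dimension; distinct objects are incident whenever one of them is
contained in the other and meets the radical of the other trivially. -/
noncomputable def quasiCTPGeometry [FiniteDimensional F V] :
    PreGeometry (QCTPObject s) (Set.Ico 1 (finrank F V)) where
  typ X := ⟨finrank F X.1, X.2.1, X.2.2.1⟩
  inc X Y := X = Y ∨ liesIn s X.1 Y.1 ∨ liesIn s Y.1 X.1
  inc_refl _ := Or.inl rfl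
  inc_symm X Y h := by
    rcases h with h | h | h
    · exact Or.inl h.symm
    · exact Or.inr (Or.inr h)
    · exact Or.inr (Or.inl h)
  eq_or_typ_ne X Y h := by
    by_cases ht : finrank F X.1 = finrank F Y.1
    · left
      rcases h with h | h | h
      · exact h
      · exact Subtype.ext (Submodule.eq_of_le_of_finrank_eq h.1 ht)
      · exact Subtype.ext (Submodule.eq_of_le_of_finrank_eq h.1 ht.symm).symm
    · right
      intro hh
      exact ht (congrArg Subtype.val hh)

theorem finrank_map_equiv (g : V ≃ₗ[F] V) (U : Submodule F V) :
    finrank F (U.map g.toLinearMap) = finrank F U :=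
  LinearEquiv.finrank_map_eq g U

theorem disjoint_map_equiv (g : V ≃ₗ[F] V) (U W : Submodule F V) :
    Disjoint (U.map g.toLinearMap) (W.map g.toLinearMap) ↔ Disjoint U W := by
  rw [disjoint_iff, disjoint_iff, ← Submodule.map_inf _ g.injective,
    Submodule.map_eq_bot_iff]

/-- `Sp(V)` acts on the objects of the geometry by taking images of subspaces. -/
instance : MulAction (SpGroup s) (QCTPObject s) where
  smul g X := ⟨X.1.map (g : V ≃ₗ[F] V).toLinearMap, by
    obtain ⟨U, h1, h2, h3, h4⟩ := X
    refine ⟨?_, ?_, ?_, ?_⟩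
    · rw [finrank_map_equiv]; exact h1
    · rw [finrank_map_equiv]; exact h2
    · have ht : formRad s ⊤ = (formRad s ⊤).map (g : V ≃ₗ[F] V).toLinearMap := by
        rw [← formRad_map]; simp
      have h := (disjoint_map_equiv (g : V ≃ₗ[F] V) U (formRad s ⊤)).mpr h3
      rw [← ht] at h
      exact h
    · rw [formRad_map, finrank_map_equiv]; exact h4⟩
  one_smul X := Subtype.ext (Submodule.map_id X.1)
  mul_smul g h X := Subtype.ext (Submodule.map_comp
    (h : V ≃ₗ[F] V).toLinearMap (g : V ≃ₗ[F] V).toLinearMap X.1)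

theorem liesIn_map (g : SpGroup s) (U W : Submodule F V) :
    liesIn s (U.map (g : V ≃ₗ[F] V).toLinearMap) (W.map (g : V ≃ₗ[F] V).toLinearMap) ↔
      liesIn s U W := by
  unfold liesIn
  rw [formRad_map, disjoint_map_equiv,
    Submodule.map_le_map_iff_of_injective (g : V ≃ₗ[F] V).injective]

theorem quasiCTPGeometry_actsByAutomorphisms [FiniteDimensional F V] :
    (quasiCTPGeometry s).ActsByAutomorphisms (SpGroup s) := by
  refine ⟨fun g X => Subtype.ext (finrank_map_equiv (g : V ≃ₗ[F] V) X.1), fun g X Y => ?_⟩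
  exact or_congr (MulAction.injective g).eq_iff
    (or_congr (liesIn_map s g X.1 Y.1) (liesIn_map s g Y.1 X.1))

end Symplectic

/-! ### Universal property of the completion -/

namespace Amalgam

variable {B : Type v} [PartialOrder B] (A : Amalgam.{u, v} B)

/-! By Tits' lemma (`isCompletion_of_cocyclesTrivial`), a group acting flag-transitively on a
connected and simply connected geometry is the universal completion of its maximal parabolics.
Simple connectivity is used in cohomological form: every group-valued cocycle `c` on incident pairs
is `c X Y = (f X)⁻¹ * f Y`. Taking the completion itself as coefficient group, the maps from the
object stabilizers into it define a cocycle; a trivialization of that cocycle yields a left inverse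
of the natural map from the completion to G, and connectedness makes the natural map surjective.

That Γ is a geometry follows by filling gaps in dimension (`exists_liesIn_between`). Transitivity on
chambers holds because each chamber has an adapted basis whose Gram matrix does not depend on the
chamber (`exists_adapted_basis`).

The main point is that cocycles are trivial. Restricted to points and hyperbolic lines, a cocycle
becomes a function `d` on pairs of non-orthogonal vectors, and `d` is multiplicative on every
triangle whose span avoids Rad(V), since that span is an object. A triangle whose span meets Rad(V)
is cut into good ones: by one extra vertex if the field has more than two elements, and otherwise by
an octahedron, which needs n ≥ 6. For n = 4 the form is nondegenerate and no bad triangle exists; n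
= 5 over the field of two elements leaves no room, whence the exception. Once all triangles are
multiplicative, so are quadrangles and pentagons; any two non-radical vectors have a common
neighbour, so these cycles suffice for a potential (`exists_potential`), which then extends from
points to all objects (`exists_coboundary`). -/

theorem toCompletion_map {β γ : B} (h : β < γ) (a : A.grp β) :
    A.toCompletion γ (A.map h a) = A.toCompletion β a := by
  have h1 := PresentedGroup.one_of_mem
    (rels := {r : FreeGroup (Σ β : B, A.grp β) | A.Relator r}) (Relator.glue β γ h a)
  rw [map_mul, map_inv] at h1
  exact (mul_inv_eq_one.mp h1).symm

/-- The homomorphism out of the universal completion induced by a compatible family. -/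
noncomputable def completionLift {G : Type w} [Group G] (φ : ∀ β, A.grp β →* G)
    (hφ : ∀ (β γ : B) (h : β < γ) (a : A.grp β), φ γ (A.map h a) = φ β a) :
    A.UniversalCompletion →* G :=
  PresentedGroup.toGroup (f := fun x : Σ β : B, A.grp β => φ x.1 x.2) (by
    rintro r (⟨β, a, b⟩ | ⟨β, γ, h, a⟩)
    · simp
    · simp [hφ])

theorem completionLift_toCompletion {G : Type w} [Group G] (φ : ∀ β, A.grp β →* G)
    (hφ : ∀ (β γ : B) (h : β < γ) (a : A.grp β), φ γ (A.map h a) = φ β a)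
    (β : B) (a : A.grp β) : A.completionLift φ hφ (A.toCompletion β a) = φ β a :=
  PresentedGroup.toGroup.of _

/-- A property of elements of the universal completion holds everywhere if it holds for `1` and is
preserved by right multiplication with the elements of the amalgam. -/
theorem completion_induction {p : A.UniversalCompletion → Prop} (h1 : p 1)
    (hmul : ∀ x β (a : A.grp β), p x → p (x * A.toCompletion β a)) (x : A.UniversalCompletion) :
    p x := by
  have hx : x ∈ Subgroup.closure (Set.range (PresentedGroup.of
      (rels := {r : FreeGroup (Σ β : B, A.grp β) | A.Relator r}))) := by
    rw [PresentedGroup.closure_range_of]; trivial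
  induction hx using Subgroup.closure_induction_right with
  | one => exact h1
  | mul_right x _ y hy hx =>
    obtain ⟨⟨β, a⟩, rfl⟩ := hy
    exact hmul x β a hx
  | mul_inv_cancel x _ y hy hx =>
    obtain ⟨⟨β, a⟩, rfl⟩ := hy
    have := hmul x β a⁻¹ hx
    rwa [map_inv] at this

end Amalgam

/-! ### Tits' lemma in cocycle form -/

/-- If every cocycle with values in `H` on the incidence relation is a coboundary, then compatible
homomorphisms from the vertex stabilizers to `H` extend to an equivariant map on `G`. -/
theorem exists_equivariant_of_cocycle_trivial {O : Type u} {I : Type v} {G H : Type*}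
    [Group G] [Group H] [MulAction G O] [Nonempty I] (typ : O → I) (inc : O → O → Prop)
    (cc : I → O) (hcc : ∀ i j, inc (cc i) (cc j)) (htyp : ∀ i (g : G), typ (g • cc i) = i)
    (hG : ∀ (g : G) X Y, inc X Y → inc (g • X) (g • Y))
    (ι : ∀ i, MulAction.stabilizer G (cc i) →* H)
    (hι : ∀ i j g hi hj, ι i ⟨g, hi⟩ = ι j ⟨g, hj⟩)
    (htrans : ∀ X Y Z, inc X Y → inc Y Z → inc X Z → ∃ g : G,
      g • cc (typ X) = X ∧ g • cc (typ Y) = Y ∧ g • cc (typ Z) = Z)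
    (hrefl : ∀ X, inc X X)
    (hcoc : ∀ c : O → O → H,
      (∀ X Y Z, inc X Y → inc Y Z → inc X Z → c X Y * c Y Z = c X Z) →
      ∃ f : O → H, ∀ X Y, inc X Y → c X Y = (f X)⁻¹ * f Y) :
    ∃ φ : G → H, φ 1 = 1 ∧ ∀ i g (p : MulAction.stabilizer G (cc i)),
      φ (g * p) = φ g * ι i p := by
  classical
  have h1 : ∀ X, ∃ g : G, g • cc (typ X) = X := fun X => by
    obtain ⟨g, hg, -⟩ := htrans X X X (hrefl X) (hrefl X) (hrefl X)
    exact ⟨g, hg⟩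
  choose γ hγ using h1
  have hst : ∀ (X : O) (h : G), h • cc (typ X) = X →
      (γ X)⁻¹ * h ∈ MulAction.stabilizer G (cc (typ X)) := by
    intro X h hX
    rw [MulAction.mem_stabilizer_iff, mul_smul, hX, inv_smul_eq_iff, hγ]
  -- `τ X h` measures `h` against the fixed representative `γ X`, inside the stabilizer of the
  -- standard object. The value 1 elsewhere is never used.
  let τ : O → G → H := fun X h =>
    if hX : h • cc (typ X) = X then ι (typ X) ⟨(γ X)⁻¹ * h, hst X h hX⟩ else 1
  have hτmul : ∀ X h (hX : h • cc (typ X) = X) (b : G)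
      (hb : b ∈ MulAction.stabilizer G (cc (typ X))),
      τ X (h * b) = τ X h * ι (typ X) ⟨b, hb⟩ := by
    intro X h hX b hb
    have hX' : (h * b) • cc (typ X) = X := by
      rw [mul_smul, MulAction.mem_stabilizer_iff.mp hb, hX]
    simp only [τ, dif_pos hX, dif_pos hX', ← map_mul]
    congr 1
    exact Subtype.ext (mul_assoc _ _ _).symm
  -- The choice of `g` is immaterial, as `hc` shows: two choices differ on the right by an element
  -- of both stabilizers, where the maps `ι` agree.
  let c : O → O → H := fun X Y =>
    if h : ∃ g : G, g • cc (typ X) = X ∧ g • cc (typ Y) = Y then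
      τ X h.choose * (τ Y h.choose)⁻¹ else 1
  have hc : ∀ X Y (g : G), g • cc (typ X) = X → g • cc (typ Y) = Y →
      c X Y = τ X g * (τ Y g)⁻¹ := by
    intro X Y g hX hY
    have h : ∃ g : G, g • cc (typ X) = X ∧ g • cc (typ Y) = Y := ⟨g, hX, hY⟩
    simp only [c, dif_pos h]
    obtain ⟨kX, kY⟩ := h.choose_spec
    set k := h.choose
    have hbX : k⁻¹ * g ∈ MulAction.stabilizer G (cc (typ X)) := by
      rw [MulAction.mem_stabilizer_iff, mul_smul, hX, inv_smul_eq_iff, kX]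
    have hbY : k⁻¹ * g ∈ MulAction.stabilizer G (cc (typ Y)) := by
      rw [MulAction.mem_stabilizer_iff, mul_smul, hY, inv_smul_eq_iff, kY]
    have e : g = k * (k⁻¹ * g) := by group
    rw [e, hτmul X k kX _ hbX, hτmul Y k kY _ hbY, hι _ _ _ hbX hbY]
    group
  obtain ⟨f, hf⟩ := hcoc c (by
    intro X Y Z hXY hYZ hXZ
    obtain ⟨g, gX, gY, gZ⟩ := htrans X Y Z hXY hYZ hXZ
    rw [hc X Y g gX gY, hc Y Z g gY gZ, hc X Z g gX gZ]
    group)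
  have hgt : ∀ i (g : G), g • cc (typ (g • cc i)) = g • cc i := fun i g => by rw [htyp]
  -- The coboundary equation says that `f X * τ X g` is the same for all `X = g • cc i`, so the maps
  -- `ψ i` are one map.
  let ψ : I → G → H := fun i g => f (g • cc i) * τ (g • cc i) g
  have hψ : ∀ i j g, ψ i g = ψ j g := by
    intro i j g
    have h2 := hc (g • cc i) (g • cc j) g (hgt i g) (hgt j g)
    rw [hf _ _ (hG g _ _ (hcc i j))] at h2
    simp only [ψ]
    rw [eq_mul_inv_iff_mul_eq, mul_assoc, inv_mul_eq_iff_eq_mul] at h2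
    exact h2.symm
  have hψmul : ∀ i g (p : MulAction.stabilizer G (cc i)), ψ i (g * p) = ψ i g * ι i p := by
    rintro i g ⟨p, hp⟩
    have e : (g * p) • cc i = g • cc i := by
      rw [mul_smul, MulAction.mem_stabilizer_iff.mp hp]
    have hp' : p ∈ MulAction.stabilizer G (cc (typ (g • cc i))) := by rw [htyp]; exact hp
    simp only [ψ, e]
    rw [hτmul _ _ (hgt i g) p hp', mul_assoc, hι _ _ _ hp' hp]
  obtain ⟨i₀⟩ := ‹Nonempty I›
  refine ⟨fun g => (ψ i₀ 1)⁻¹ * ψ i₀ g, by simp, fun i g p => ?_⟩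
  change _ * ψ i₀ (g * p) = _ * ψ i₀ g * _
  rw [hψ i₀ i (g * p), hψmul, hψ i i₀ g]
  exact (mul_assoc _ _ _).symm

namespace PreGeometry

variable {O : Type u} {I : Type v} (Γ : PreGeometry O I) (G : Type w) [Group G] [MulAction G O]

/-- The incidence graph is connected. -/
def IncConnected : Prop :=
  ∀ S : Set O, (∀ X Y, X ∈ S → Γ.inc X Y → Y ∈ S) → S.Nonempty → S = Set.univ

/-- Every `H`-valued cocycle on the flag complex is a coboundary. -/
def CocyclesTrivial (H : Type*) [Group H] : Prop :=
  ∀ c : O → O → H,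
    (∀ X Y Z, Γ.inc X Y → Γ.inc Y Z → Γ.inc X Z → c X Y * c Y Z = c X Z) →
    ∃ f : O → H, ∀ X Y, Γ.inc X Y → c X Y = (f X)⁻¹ * f Y

variable {Γ} in
theorem IsFlag.eq_of_typ_eq {E : Set O} (hE : Γ.IsFlag E) {X Y : O} (hX : X ∈ E) (hY : Y ∈ E)
    (h : Γ.typ X = Γ.typ Y) : X = Y :=
  (Γ.eq_or_typ_ne X Y (hE X hX Y hY)).resolve_right fun h' => h' h

/-- It suffices to be transitive on the chambers of a geometry. -/
theorem actsFlagTransitively_of_chambers (hgeo : Γ.IsGeometry) (hG : Γ.ActsByAutomorphisms G)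
    (h : ∀ C D, Γ.IsChamber C → Γ.IsChamber D → ∃ g : G, (fun X => g • X) '' C = D) :
    Γ.ActsFlagTransitively G := by
  refine ⟨hG, fun J E₁ E₂ h₁ t₁ h₂ t₂ => ?_⟩
  obtain ⟨C, hC, hEC⟩ := hgeo.2 E₁ h₁
  obtain ⟨D, hD, hED⟩ := hgeo.2 E₂ h₂
  obtain ⟨g, hg⟩ := h C D hC hD
  have key : ∀ X ∈ E₁, ∀ Y ∈ E₂, Γ.typ X = Γ.typ Y → g • X = Y := fun X hX Y hY hXY =>
    hD.1.eq_of_typ_eq (hg ▸ ⟨X, hEC hX, rfl⟩) (hED hY) (by rw [hG.1, hXY])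
  refine ⟨g, Set.Subset.antisymm ?_ ?_⟩
  · rintro _ ⟨X, hX, rfl⟩
    have : Γ.typ X ∈ Γ.flagType E₂ := by rw [t₂, ← t₁]; exact ⟨X, hX, rfl⟩
    obtain ⟨Y, hY, hYX⟩ := this
    simp only [key X hX Y hY hYX.symm, hY]
  · intro Y hY
    have : Γ.typ Y ∈ Γ.flagType E₁ := by rw [t₁, ← t₂]; exact ⟨Y, hY, rfl⟩
    obtain ⟨X, hX, hXY⟩ := this
    exact ⟨X, hX, key X hX Y hY hXY⟩

/-- Tits' lemma: a flag-transitive automorphism group of a connected and simply connected geometry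
is the universal completion of the amalgam of its maximal parabolic subgroups. -/
theorem isCompletion_of_cocyclesTrivial [Nonempty I] (hft : Γ.ActsFlagTransitively G)
    (hG : Γ.ActsByAutomorphisms G) (C : Set O) (hC : Γ.IsChamber C) (hconn : Γ.IncConnected)
    (hcoc : Γ.CocyclesTrivial (Γ.maximalParabolicAmalgam G hG C).UniversalCompletion) :
    Γ.IsCompletionOfMaximalParabolics G hG C := by
  classical
  have hex : ∀ i, ∃ X ∈ C, Γ.typ X = i := fun i => by
    have : i ∈ Γ.flagType C := by rw [hC.2]; trivial
    exact this
  choose cc hccC hcct using hex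
  -- Types are preserved and a flag has at most one object of each type, so stabilizing a subflag
  -- setwise means fixing each of its elements.
  have hmem : ∀ J g, g ∈ Γ.parabolic G C J ↔ ∀ i ∉ J, g • cc i = cc i := by
    intro J g
    change (fun X => g • X) '' Γ.cotypeFlag C J = Γ.cotypeFlag C J ↔ _
    have e : ∀ X ∈ Γ.cotypeFlag C J, X = cc (Γ.typ X) := fun X hX =>
      hC.1.eq_of_typ_eq hX.1 (hccC _) (hcct _).symm
    constructor
    · intro h i hi
      have h1 : g • cc i ∈ Γ.cotypeFlag C J := by
        rw [← h]
        exact ⟨cc i, ⟨hccC i, by rwa [hcct]⟩, rfl⟩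
      exact hC.1.eq_of_typ_eq h1.1 (hccC i) (hG.1 _ _)
    · intro h
      have h2 : ∀ X ∈ Γ.cotypeFlag C J, g • X = X := fun X hX => by
        rw [e X hX]; exact h _ hX.2
      ext X
      exact ⟨by rintro ⟨Y, hY, rfl⟩; simpa only [h2 Y hY] using hY, fun hX => ⟨X, hX, h2 X hX⟩⟩
  set A := Γ.maximalParabolicAmalgam G hG C with hA
  have hlt : ∀ i : I, ({i}ᶜ : Set I) ≠ Set.univ := fun i h => by
    have : i ∈ ({i}ᶜ : Set I) := by rw [h]; trivial
    exact this rfl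
  have hstab : ∀ i, MulAction.stabilizer G (cc i) ≤ Γ.parabolic G C {i}ᶜ := by
    intro i g hg
    rw [hmem]
    intro j hj
    rw [Set.notMem_compl_iff] at hj
    rw [Set.mem_singleton_iff.mp hj]
    exact hg
  have hglue : ∀ (J K : {J : Set I // J ≠ Set.univ}) (_ : J ≤ K) (g : G)
      (hJ : g ∈ Γ.parabolic G C J.1) (hK : g ∈ Γ.parabolic G C K.1),
      A.toCompletion J ⟨g, hJ⟩ = A.toCompletion K ⟨g, hK⟩ := by
    intro J K h g hJ hK
    rcases h.eq_or_lt with rfl | h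
    · rfl
    · exact (A.toCompletion_map h ⟨g, hJ⟩).symm
  let ι : ∀ i, MulAction.stabilizer G (cc i) →* A.UniversalCompletion := fun i =>
    (A.toCompletion ⟨{i}ᶜ, hlt i⟩).comp (Subgroup.inclusion (hstab i))
  -- An element fixing both `cc i` and `cc j` lies in the parabolic of type `{i, j}ᶜ`, a member of
  -- the amalgam that is glued to both sides.
  have hι : ∀ i j g hi hj, ι i ⟨g, hi⟩ = ι j ⟨g, hj⟩ := by
    intro i j g hi hj
    have hne : ({i, j}ᶜ : Set I) ≠ Set.univ := fun h => by
      have : i ∈ ({i, j}ᶜ : Set I) := by rw [h]; trivial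
      exact this (Or.inl rfl)
    have hg : g ∈ Γ.parabolic G C {i, j}ᶜ := by
      rw [hmem]
      intro k hk
      rw [Set.notMem_compl_iff] at hk
      rcases hk with rfl | rfl
      · exact hi
      · exact hj
    have h1 := hglue ⟨_, hne⟩ ⟨_, hlt i⟩
      (Set.compl_subset_compl.mpr (by simp)) g hg (hstab i hi)
    have h2 := hglue ⟨_, hne⟩ ⟨_, hlt j⟩
      (Set.compl_subset_compl.mpr (by simp)) g hg (hstab j hj)
    exact h1.symm.trans h2
  have htrans : ∀ X Y Z, Γ.inc X Y → Γ.inc Y Z → Γ.inc X Z → ∃ g : G,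
      g • cc (Γ.typ X) = X ∧ g • cc (Γ.typ Y) = Y ∧ g • cc (Γ.typ Z) = Z := by
    intro X Y Z hXY hYZ hXZ
    have hfl : Γ.IsFlag {X, Y, Z} := by
      rintro A (rfl | rfl | rfl) B (rfl | rfl | rfl) <;>
        first
        | exact Γ.inc_refl _
        | assumption
        | exact Γ.inc_symm _ _ ‹_›
    have hfl' : Γ.IsFlag {cc (Γ.typ X), cc (Γ.typ Y), cc (Γ.typ Z)} := by
      rintro A hA B hB
      refine hC.1 A ?_ B ?_
      · rcases hA with rfl | rfl | rfl <;> exact hccC _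
      · rcases hB with rfl | rfl | rfl <;> exact hccC _
    obtain ⟨g, hg⟩ := hft.2 _ _ _ hfl' rfl hfl (by simp [flagType, Set.image_insert_eq, hcct])
    have key : ∀ W ∈ ({X, Y, Z} : Set O), g • cc (Γ.typ W) = W := by
      intro W hW
      refine hfl.eq_of_typ_eq ?_ hW (by rw [hG.1, hcct])
      rw [← hg]
      refine ⟨_, ?_, rfl⟩
      rcases hW with rfl | rfl | rfl <;> simp
    exact ⟨g, key X (by simp), key Y (by simp), key Z (by simp)⟩
  obtain ⟨φ, hφ1, hφ⟩ := exists_equivariant_of_cocycle_trivial (G := G) Γ.typ Γ.inc cc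
    (fun i j => hC.1 _ (hccC i) _ (hccC j)) (fun i g => by rw [hG.1, hcct])
    (fun g X Y h => (hG.2 g X Y).mpr h) ι hι htrans Γ.inc_refl hcoc
  let π : A.UniversalCompletion →* G := A.completionLift
    (fun J => (Γ.parabolic G C J.1).subtype) (fun _ _ _ _ => rfl)
  have hπ : ∀ (J : {J : Set I // J ≠ Set.univ}) (x : Γ.parabolic G C J.1),
      π (A.toCompletion J x) = (x : G) := fun J x =>
    A.completionLift_toCompletion _ _ J x
  have hφπ : ∀ x, φ (π x) = x := by
    intro x
    induction x using A.completion_induction with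
    | h1 => rw [map_one, hφ1]
    | hmul x J a ih =>
      obtain ⟨g, hg⟩ := a
      -- `J` is proper, so each generator fixes some `cc i` and the equivariance of `φ` applies to
      -- it.
      obtain ⟨i, hi⟩ := (Set.ne_univ_iff_exists_notMem J.1).mp J.2
      have hgi : g ∈ MulAction.stabilizer G (cc i) := (hmem J.1 g).mp hg i hi
      have h3 := hφ i (π x) ⟨g, hgi⟩
      rw [map_mul, hπ]
      change φ (π x * g) = _
      rw [h3, ih]
      congr 1
      exact (hglue J ⟨_, hlt i⟩ (fun k hk => fun hki => hi (hki ▸ hk)) g hg (hstab i hgi)).symm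
  have hsurj : Function.Surjective π := by
    have hst : ∀ i, MulAction.stabilizer G (cc i) ≤ π.range := fun i g hg =>
      ⟨A.toCompletion ⟨{i}ᶜ, hlt i⟩ ⟨g, hstab i hg⟩, hπ _ _⟩
    obtain ⟨i₀⟩ := ‹Nonempty I›
    -- The objects reached from the standard ones by the image of `π` are closed under incidence,
    -- because that image contains all stabilizers of standard objects.
    have hS := hconn {X | ∃ n ∈ π.range, n • cc (Γ.typ X) = X} (by
      rintro X Y ⟨n, hn, hnX⟩ hXY
      obtain ⟨g, gX, gY, -⟩ := htrans X Y Y hXY (Γ.inc_refl Y) hXY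
      refine ⟨g, ?_, gY⟩
      have h4 : n⁻¹ * g ∈ MulAction.stabilizer G (cc (Γ.typ X)) := by
        rw [MulAction.mem_stabilizer_iff, mul_smul, gX, inv_smul_eq_iff, hnX]
      have := π.range.mul_mem hn (hst _ h4)
      rwa [mul_inv_cancel_left] at this) ⟨cc i₀, 1, one_mem _, by rw [hcct, one_smul]⟩
    intro g
    have h5 : g • cc i₀ ∈ {X | ∃ n ∈ π.range, n • cc (Γ.typ X) = X} := by rw [hS]; trivial
    obtain ⟨n, hn, hng⟩ := h5
    rw [hG.1, hcct] at hng
    have h4 : n⁻¹ * g ∈ MulAction.stabilizer G (cc i₀) := by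
      rw [MulAction.mem_stabilizer_iff, mul_smul, ← hng, inv_smul_smul]
    have := π.range.mul_mem hn (hst _ h4)
    rwa [mul_inv_cancel_left] at this
  exact ⟨MulEquiv.ofBijective π ⟨(Function.LeftInverse.injective hφπ), hsurj⟩, hπ⟩

end PreGeometry

/-! ### Every flag lies in a chamber -/

section Symplectic

variable {F : Type u} {V : Type v} [Field F] [AddCommGroup V] [Module F V]
  {s : LinearMap.BilinForm F V}

theorem formRad_le (U : Submodule F V) : formRad s U ≤ U := inf_le_left

theorem mem_formRad_of_le {U W : Submodule F V} (h : U ≤ W) {x : V} (hx : x ∈ U)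
    (hxW : x ∈ formRad s W) : x ∈ formRad s U :=
  ⟨hx, fun y hy => hxW.2 y (h hy)⟩

theorem liesIn.trans {X Y Z : Submodule F V} (h₁ : liesIn s X Y) (h₂ : liesIn s Y Z) :
    liesIn s X Z :=
  ⟨h₁.1.trans h₂.1, h₂.2.mono_left h₁.1⟩

/-- The intersection of X with Rad(Y) is contained in Rad(X). -/
theorem liesIn_of_formRad_eq_bot {X Y : Submodule F V} (h : X ≤ Y) (hX : formRad s X = ⊥) :
    liesIn s X Y := by
  refine ⟨h, Submodule.disjoint_def.mpr fun x hx hxY => ?_⟩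
  have := mem_formRad_of_le h hx hxY
  rwa [hX] at this

theorem form_swap (hs : s.IsAlt) (x y : V) : s x y = -s y x := (hs.neg_eq y x).symm

theorem form_swap_eq_zero (hs : s.IsAlt) {x y : V} (h : s x y = 0) : s y x = 0 := by
  rw [form_swap hs, h, neg_zero]

theorem form_swap_ne_zero (hs : s.IsAlt) {x y : V} (h : s x y ≠ 0) : s y x ≠ 0 :=
  fun h' => h (form_swap_eq_zero hs h')

variable (s) in
/-- `Y` is incident with `X` in the sense of the geometry, for arbitrary subspaces. -/
def SubspaceInc (X Y : Submodule F V) : Prop := X = Y ∨ liesIn s X Y ∨ liesIn s Y X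

theorem SubspaceInc.symm {X Y : Submodule F V} (h : SubspaceInc s X Y) : SubspaceInc s Y X := by
  rcases h with h | h | h
  · exact Or.inl h.symm
  · exact Or.inr (Or.inr h)
  · exact Or.inr (Or.inl h)

variable [FiniteDimensional F V]

theorem finrank_sup_span_singleton {X : Submodule F V} {v : V} (h : v ∉ X) :
    finrank F (X ⊔ F ∙ v : Submodule F V) = finrank F X + 1 := by
  have hd : Disjoint X (F ∙ v) := Submodule.disjoint_span_singleton_of_notMem h
  have h1 := Submodule.finrank_sup_add_finrank_inf_eq X (F ∙ v)
  rw [hd.eq_bot, finrank_bot,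
    finrank_span_singleton fun h0 : v = 0 => h (by rw [h0]; exact X.zero_mem)] at h1
  omega

theorem exists_smul_of_finrank_le_one {R : Submodule F V} (hR : finrank F R ≤ 1) {r : V}
    (hr : r ∈ R) (hr0 : r ≠ 0) {x : V} (hx : x ∈ R) : ∃ a : F, a • r = x := by
  have h1 : (F ∙ r) = R := Submodule.eq_of_le_of_finrank_le
    ((Submodule.span_singleton_le_iff_mem _ _).mpr hr) (by rwa [finrank_span_singleton hr0])
  rw [← h1] at hx
  exact Submodule.mem_span_singleton.mp hx

/-- Orthogonal projection along a subspace on which the form is nondegenerate. -/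
theorem exists_add_mem_orthogonal (hs : s.IsAlt) {X : Submodule F V} (hX : formRad s X = ⊥)
    (v : V) : ∃ x ∈ X, ∃ w, (∀ y ∈ X, s y w = 0) ∧ x + w = v := by
  have hc := LinearMap.BilinForm.isCompl_orthogonal_of_restrict_nondegenerate hs.isRefl
    (s.nondegenerate_restrict_of_disjoint_orthogonal hs.isRefl (disjoint_iff.mpr hX))
  have hv : v ∈ X ⊔ s.orthogonal X := by rw [hc.sup_eq_top]; trivial
  obtain ⟨x, hx, w, hw, h⟩ := Submodule.mem_sup.mp hv
  exact ⟨x, hx, w, hw, h⟩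

/-- If Rad(X) = 0, adjoin a vector of Y orthogonal to X and outside Rad(Y); without one, Y would lie
in X + Rad(Y), of dimension at most dim X + 1. The new vector then spans a line containing the
radical of the sum. If Rad(X) is spanned by r, adjoin a vector of Y not orthogonal to r, which makes
the sum nondegenerate. -/
theorem exists_liesIn_between (hs : s.IsAlt) {X Y : Submodule F V} (hXY : liesIn s X Y)
    (hX : finrank F (formRad s X) ≤ 1) (hY : finrank F (formRad s Y) ≤ 1)
    (h : finrank F X + 2 ≤ finrank F Y) :
    ∃ Z, liesIn s X Z ∧ liesIn s Z Y ∧ finrank F Z = finrank F X + 1 ∧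
      finrank F (formRad s Z) ≤ 1 := by
  by_cases hb : formRad s X = ⊥
  · have hv : ∃ v ∈ Y, (∀ y ∈ X, s y v = 0) ∧ v ∉ formRad s Y := by
      by_contra! hcon
      have hle : Y ≤ X ⊔ formRad s Y := by
        intro y hy
        obtain ⟨x, hx, w, hw, rfl⟩ := exists_add_mem_orthogonal hs hb y
        exact Submodule.add_mem_sup hx
          (hcon w ((Submodule.add_mem_iff_right Y (hXY.1 hx)).mp hy) hw)
      have h1 := Submodule.finrank_mono hle
      have h2 := Submodule.finrank_add_le_finrank_add_finrank X (formRad s Y)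
      omega
    obtain ⟨v, hvY, hvX, hvr⟩ := hv
    have hX0 : ∀ x ∈ X, (∀ y ∈ X, s y x = 0) → x = 0 := fun x hx hy => by
      have : x ∈ formRad s X := ⟨hx, hy⟩
      rwa [hb] at this
    have hvnX : v ∉ X := fun hv => hvr (by rw [hX0 v hv hvX]; exact zero_mem _)
    have hZY : X ⊔ F ∙ v ≤ Y :=
      sup_le hXY.1 ((Submodule.span_singleton_le_iff_mem _ _).mpr hvY)
    have hperp : ∀ z ∈ X ⊔ F ∙ v, (∀ y ∈ X, s y z = 0) → ∃ a : F, a • v = z := by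
      intro z hz hzX
      obtain ⟨x, hx, w, hw, rfl⟩ := Submodule.mem_sup.mp hz
      obtain ⟨a, rfl⟩ := Submodule.mem_span_singleton.mp hw
      refine ⟨a, ?_⟩
      rw [hX0 x hx fun y hy => by simpa [hvX y hy] using hzX y hy, zero_add]
    refine ⟨X ⊔ F ∙ v, liesIn_of_formRad_eq_bot le_sup_left hb, ⟨hZY, ?_⟩,
      finrank_sup_span_singleton hvnX, ?_⟩
    · refine Submodule.disjoint_def.mpr fun z hz hzY => ?_
      obtain ⟨a, rfl⟩ := hperp z hz fun y hy => hzY.2 y (hXY.1 hy)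
      by_contra hne
      have ha : a ≠ 0 := fun ha => hne (by rw [ha, zero_smul])
      exact hvr ((Submodule.smul_mem_iff _ ha).mp hzY)
    · have hle : formRad s (X ⊔ F ∙ v) ≤ F ∙ v := fun z hz =>
        Submodule.mem_span_singleton.mpr
          (hperp z hz.1 fun y hy => hz.2 y (Submodule.mem_sup_left hy))
      exact (Submodule.finrank_mono hle).trans (finrank_span_le_card ({v} : Set V)) |>.trans
        (by simp)
  · obtain ⟨r, hr, hr0⟩ := Submodule.exists_mem_ne_zero_of_ne_bot hb
    have hv : ∃ v ∈ Y, s v r ≠ 0 := by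
      by_contra! hcon
      exact hr0 (Submodule.disjoint_def.mp hXY.2 r hr.1 ⟨hXY.1 hr.1, hcon⟩)
    obtain ⟨v, hvY, hvr⟩ := hv
    have hvnX : v ∉ X := fun hv => hvr (hr.2 v hv)
    have hZY : X ⊔ F ∙ v ≤ Y :=
      sup_le hXY.1 ((Submodule.span_singleton_le_iff_mem _ _).mpr hvY)
    have hZ : formRad s (X ⊔ F ∙ v) = ⊥ := by
      rw [eq_bot_iff]
      rintro z ⟨hz, hz'⟩
      obtain ⟨x, hx, w, hw, rfl⟩ := Submodule.mem_sup.mp hz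
      obtain ⟨a, rfl⟩ := Submodule.mem_span_singleton.mp hw
      have h1 := hz' r (Submodule.mem_sup_left hr.1)
      have hrx : s r x = 0 := form_swap_eq_zero hs (hr.2 x hx)
      rw [map_add, map_smul, hrx, zero_add, smul_eq_mul] at h1
      have ha : a = 0 := (mul_eq_zero.mp h1).resolve_right (form_swap_ne_zero hs hvr)
      rw [ha, zero_smul, add_zero] at hz' ⊢
      obtain ⟨c, rfl⟩ := exists_smul_of_finrank_le_one hX hr hr0
        (x := x) ⟨hx, fun y hy => hz' y (Submodule.mem_sup_left hy)⟩
      have h2 := hz' v (Submodule.mem_sup_right (Submodule.mem_span_singleton_self v))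
      rw [map_smul, smul_eq_mul] at h2
      rw [(mul_eq_zero.mp h2).resolve_right hvr, zero_smul]
      exact zero_mem _
    refine ⟨X ⊔ F ∙ v, ⟨le_sup_left, ?_⟩, liesIn_of_formRad_eq_bot hZY hZ,
      finrank_sup_span_singleton hvnX, ?_⟩
    · rw [hZ]; exact disjoint_bot_right
    · rw [hZ, finrank_bot]; exact zero_le_one

theorem quasiCTPGeometry_inc {X Y : QCTPObject s} :
    (quasiCTPGeometry s).inc X Y ↔ SubspaceInc s X.1 Y.1 :=
  or_congr Subtype.ext_iff Iff.rfl

theorem SubspaceInc.liesIn_of_lt {X Y : Submodule F V} (h : SubspaceInc s X Y)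
    (hlt : finrank F X < finrank F Y) : liesIn s X Y := by
  rcases h with h | h | h
  · rw [h] at hlt; omega
  · exact h
  · have := Submodule.finrank_mono h.1
    omega

theorem exists_isChamber (hs : s.IsAlt) (hrad : finrank F (formRad s ⊤) ≤ 1)
    (E : Set (QCTPObject s)) (hE : (quasiCTPGeometry s).IsFlag E) :
    ∃ C, (quasiCTPGeometry s).IsChamber C ∧ E ⊆ C := by
  have hch : IsChain (quasiCTPGeometry s).inc E := fun X hX Y hY _ => Or.inl (hE X hX Y hY)
  obtain ⟨C, hC, hEC⟩ := hch.exists_maxChain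
  have hfl : (quasiCTPGeometry s).IsFlag C := by
    intro X hX Y hY
    by_cases h : X = Y
    · rw [h]; exact (quasiCTPGeometry s).inc_refl Y
    · exact (hC.1 hX hY h).elim id ((quasiCTPGeometry s).inc_symm _ _)
  refine ⟨C, ⟨hfl, Set.eq_univ_of_forall ?_⟩, hEC⟩
  rintro ⟨i, hi1, hin⟩
  by_contra hmiss
  -- The ends ⊥ and ⊤ are added so that every gap has two sides; lying in ⊤ in the sense of `liesIn`
  -- is precisely avoiding Rad(V).
  let S : Set (Submodule F V) := {U | U = ⊥ ∨ U = ⊤ ∨ ∃ X ∈ C, X.1 = U}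
  have hne : ∀ U ∈ S, finrank F U ≠ i := by
    rintro U (rfl | rfl | ⟨X, hX, rfl⟩) h
    · rw [finrank_bot] at h; omega
    · rw [finrank_top] at h; omega
    · exact hmiss ⟨X, hX, Subtype.ext h⟩
  have hinc : ∀ U ∈ S, ∀ W ∈ S, finrank F U < finrank F W → liesIn s U W := by
    rintro U hU W hW hlt
    rcases hU with rfl | rfl | ⟨X, hX, rfl⟩
    · exact ⟨bot_le, disjoint_bot_left⟩
    · have := Submodule.finrank_le W
      rw [finrank_top] at hlt; omega
    · rcases hW with rfl | rfl | ⟨Y, hY, rfl⟩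
      · rw [finrank_bot] at hlt; omega
      · exact ⟨le_top, X.2.2.2.1⟩
      · exact (quasiCTPGeometry_inc.mp (hfl X hX Y hY)).liesIn_of_lt hlt
  have hr : ∀ U ∈ S, finrank F (formRad s U) ≤ 1 := by
    rintro U (rfl | rfl | ⟨X, hX, rfl⟩)
    · exact (Submodule.finrank_mono (formRad_le _)).trans (by rw [finrank_bot]; exact zero_le_one)
    · exact hrad
    · exact X.2.2.2.2
  obtain ⟨X, ⟨hXS, hXi⟩, hXmax⟩ : ∃ X, (X ∈ S ∧ finrank F X < i) ∧
      ∀ U, (U ∈ S ∧ finrank F U < i) → finrank F U ≤ finrank F X := by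
    have hbdd : BddAbove {k | ∃ U, (U ∈ S ∧ finrank F U < i) ∧ finrank F U = k} :=
      ⟨i, by rintro _ ⟨U, hU, rfl⟩; exact hU.2.le⟩
    obtain ⟨X, hX, hXk⟩ := Nat.sSup_mem (s := {k | ∃ U, (U ∈ S ∧ finrank F U < i) ∧ finrank F U = k})
      ⟨0, ⊥, ⟨Or.inl rfl, by rw [finrank_bot]; omega⟩, finrank_bot F V⟩ hbdd
    exact ⟨X, hX, fun U hU => hXk ▸ le_csSup hbdd ⟨U, hU, rfl⟩⟩
  obtain ⟨Y, ⟨hYS, hYi⟩, hYmin⟩ : ∃ Y, (Y ∈ S ∧ i < finrank F Y) ∧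
      ∀ U, (U ∈ S ∧ i < finrank F U) → finrank F Y ≤ finrank F U := by
    obtain ⟨Y, hY, hYk⟩ := Nat.sInf_mem (s := {k | ∃ U, (U ∈ S ∧ i < finrank F U) ∧ finrank F U = k})
      ⟨_, ⊤, ⟨Or.inr (Or.inl rfl), by rw [finrank_top]; omega⟩, rfl⟩
    exact ⟨Y, hY, fun U hU => hYk ▸ Nat.sInf_le ⟨U, hU, rfl⟩⟩
  obtain ⟨Z, hXZ, hZY, hZd, hZr⟩ := exists_liesIn_between hs
    (hinc X hXS Y hYS (by omega)) (hr X hXS) (hr Y hYS) (by omega)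
  have hlow : ∀ U ∈ S, finrank F U < i → SubspaceInc s U Z := by
    intro U hU hUi
    rcases (hXmax U ⟨hU, hUi⟩).eq_or_lt with h | h
    · have : U = X := by
        rcases hU with rfl | rfl | ⟨U, hUC, rfl⟩
        · rw [finrank_bot] at h
          exact (Submodule.finrank_eq_zero.mp h.symm).symm
        · rw [finrank_top] at hUi; omega
        · rcases hXS with rfl | rfl | ⟨X, hXC, rfl⟩
          · rw [finrank_bot] at h
            exact Submodule.finrank_eq_zero.mp h
          · rw [finrank_top] at hXi; omega
          · rw [hfl.eq_of_typ_eq hUC hXC (Subtype.ext h)]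
      rw [this]; exact Or.inr (Or.inl hXZ)
    · exact Or.inr (Or.inl ((hinc U hU X hXS h).trans hXZ))
  have hhigh : ∀ U ∈ S, i < finrank F U → SubspaceInc s Z U := by
    intro U hU hUi
    rcases (hYmin U ⟨hU, hUi⟩).eq_or_lt with h | h
    · have : U = Y := by
        rcases hU with rfl | rfl | ⟨U, hUC, rfl⟩
        · rw [finrank_bot] at hUi; omega
        · rw [finrank_top] at h
          exact (Submodule.eq_top_of_finrank_eq h).symm
        · rcases hYS with rfl | rfl | ⟨Y, hYC, rfl⟩
          · rw [finrank_bot] at hYi; omega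
          · rw [finrank_top] at h
            exact Submodule.eq_top_of_finrank_eq h.symm
          · rw [hfl.eq_of_typ_eq hUC hYC (Subtype.ext h.symm)]
      rw [this]; exact Or.inr (Or.inl hZY)
    · exact Or.inr (Or.inl (hZY.trans (hinc Y hYS U hU h)))
  have hYn := Submodule.finrank_le Y
  have hZtop : liesIn s Z ⊤ := by
    rcases hhigh ⊤ (Or.inr (Or.inl rfl)) (by rwa [finrank_top]) with h | h | h
    · rw [h, finrank_top] at hZd
      omega
    · exact h
    · have := Submodule.finrank_mono h.1
      rw [finrank_top] at this; omega
  let Z' : QCTPObject s := ⟨Z, by omega, by omega, hZtop.2, hZr⟩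
  have hZC : Z' ∈ C := by
    have hins : IsChain (quasiCTPGeometry s).inc (insert Z' C) := by
      refine hC.1.insert fun W hW _ => Or.inl (quasiCTPGeometry_inc.mpr ?_)
      have hWS : W.1 ∈ S := Or.inr (Or.inr ⟨W, hW, rfl⟩)
      rcases (hne _ hWS).lt_or_gt with h | h
      · exact (hlow _ hWS h).symm
      · exact hhigh _ hWS h
    rw [hC.2 hins (Set.subset_insert _ _)]
    exact Set.mem_insert _ _
  -- `Z` has dimension dim `X` + 1 ≤ `i`. Dimension `i` is missing from `S`, and a smaller one
  -- contradicts the choice of `X`.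
  have hZS : Z ∈ S := Or.inr (Or.inr ⟨Z', hZC, rfl⟩)
  have h1 := hne Z hZS
  have h2 := hXmax Z ⟨hZS, by omega⟩
  omega

theorem quasiCTPGeometry_isGeometry (hs : s.IsAlt) (hrad : finrank F (formRad s ⊤) ≤ 1) :
    (quasiCTPGeometry s).IsGeometry := by
  refine ⟨?_, exists_isChamber hs hrad⟩
  obtain ⟨C, hC, -⟩ := exists_isChamber hs hrad ∅ (by simp [PreGeometry.IsFlag])
  exact Set.eq_univ_of_univ_subset (hC.2 ▸ Set.image_subset_range _ _)

end Symplectic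

/-! ### Adapted bases and transitivity on chambers -/

section Symplectic

variable {F : Type u} {V : Type v} [Field F] [AddCommGroup V] [Module F V]
  {s : LinearMap.BilinForm F V}

variable (F) in
/-- The Gram matrix of an orthogonal sequence of hyperbolic pairs. -/
def hyperbolicGram (j k : ℕ) : F :=
  if k = j + 1 ∧ Even j then 1 else if j = k + 1 ∧ Even k then -1 else 0

theorem span_image_Iio_succ (b : ℕ → V) (k : ℕ) :
    Submodule.span F (b '' Set.Iio (k + 1)) = Submodule.span F (b '' Set.Iio k) ⊔ F ∙ b k := by
  rw [← Order.succ_eq_add_one, Order.Iio_succ_eq_insert, Set.image_insert_eq,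
    Submodule.span_insert, sup_comm]

theorem image_update_Iio {α : Type*} (b : ℕ → α) (w : α) {k i : ℕ} (h : k ≤ i) :
    Function.update b i w '' Set.Iio k = b '' Set.Iio k :=
  Set.image_congr fun _ hj =>
    Function.update_of_ne (ne_of_lt (lt_of_lt_of_le (Set.mem_Iio.mp hj) h)) _ _

theorem gram_update (hs : s.IsAlt) {b : ℕ → V} {i : ℕ} {w : V}
    (hb : ∀ j < i, ∀ k < i, s (b j) (b k) = hyperbolicGram F j k)
    (hw : ∀ j < i, s (b j) w = hyperbolicGram F j i) :
    ∀ j < i + 1, ∀ k < i + 1,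
      s (Function.update b i w j) (Function.update b i w k) = hyperbolicGram F j k := by
  intro j hj k hk
  rcases (Nat.lt_succ_iff_lt_or_eq.mp hj) with hj | rfl <;>
    rcases (Nat.lt_succ_iff_lt_or_eq.mp hk) with hk | rfl
  · rw [Function.update_of_ne hj.ne, Function.update_of_ne hk.ne, hb j hj k hk]
  · rw [Function.update_of_ne hj.ne, Function.update_self, hw j hj]
  · rw [Function.update_of_ne hk.ne, Function.update_self, form_swap hs, hw k hk]
    have h1 : ¬ (k = j + 1) := by omega
    simp only [hyperbolicGram, h1, false_and, if_false]
    have h2 : ¬ (k = j + 1) := by omega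
    split_ifs <;> simp_all
  · rw [Function.update_self, hs w]
    simp [hyperbolicGram]

variable [FiniteDimensional F V]

theorem sup_span_singleton_eq {X Y : Submodule F V} (h : X ≤ Y)
    (hd : finrank F Y = finrank F X + 1) {v : V} (hv : v ∈ Y) (hvX : v ∉ X) :
    X ⊔ F ∙ v = Y :=
  Submodule.eq_of_le_of_finrank_eq
    (sup_le h ((Submodule.span_singleton_le_iff_mem _ _).mpr hv))
    (by rw [finrank_sup_span_singleton hvX, hd])

/-- A full chain of subspaces as in a chamber has an adapted hyperbolic basis. -/
theorem exists_adapted_basis (hs : s.IsAlt) {n : ℕ} {X : ℕ → Submodule F V} (hX0 : X 0 = ⊥)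
    (hdim : ∀ i ≤ n, finrank F (X i) = i) (hX : ∀ i < n, liesIn s (X i) (X (i + 1))) :
    ∀ i ≤ n, ∃ b : ℕ → V, (∀ k ≤ i, Submodule.span F (b '' Set.Iio k) = X k) ∧
      (∀ j < i, ∀ k < i, s (b j) (b k) = hyperbolicGram F j k) ∧
      ∀ k ≤ i, Even k → formRad s (X k) = ⊥ := by
  intro i
  induction i with
  | zero =>
    refine fun _ => ⟨fun _ => 0, fun k hk => ?_, fun j hj => absurd hj (Nat.not_lt_zero j),
      fun k hk _ => ?_⟩ <;> obtain rfl : k = 0 := by omega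
    · rw [hX0]; simp
    · rw [hX0, eq_bot_iff]; exact formRad_le _
  | succ i ih =>
    intro hi
    obtain ⟨b, hspan, hgram, hev⟩ := ih (by omega)
    have hle : X i ≤ X (i + 1) := (hX i (by omega)).1
    have hd : finrank F (X (i + 1)) = finrank F (X i) + 1 := by
      rw [hdim _ hi, hdim i (by omega)]
    have hbmem : ∀ k ≤ i, ∀ j < k, b j ∈ X k := fun k hk j hj => by
      rw [← hspan k hk]; exact Submodule.subset_span ⟨j, hj, rfl⟩
    have hspan' : ∀ w ∈ X (i + 1), w ∉ X i → ∀ k ≤ i + 1,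
        Submodule.span F (Function.update b i w '' Set.Iio k) = X k := by
      intro w hw hwX k hk
      rcases Nat.le_succ_iff.mp hk with hk | rfl
      · rw [image_update_Iio b w hk, hspan k hk]
      · rw [Nat.succ_eq_add_one, span_image_Iio_succ, image_update_Iio b w le_rfl,
          hspan i le_rfl, Function.update_self, sup_span_singleton_eq hle hd hw hwX]
    -- For even `i` the space `X i` is nondegenerate, so the new vector can be chosen orthogonal to
    -- it. For odd `i = k + 1` the vector `b k` lies in the radical of `X (k + 1)`, which avoids the
    -- radical of `X (k + 2)`; hence some vector there pairs nontrivially with `b k`, and projecting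
    -- it off `X k` and scaling gives the hyperbolic partner.
    rcases Nat.even_or_odd i with he | ho
    · obtain ⟨v, hv, hvX⟩ : ∃ v ∈ X (i + 1), v ∉ X i := by
        by_contra! hcon
        have := Submodule.finrank_mono (show X (i + 1) ≤ X i from hcon)
        omega
      obtain ⟨x, hx, w, hw, rfl⟩ := exists_add_mem_orthogonal hs (hev i le_rfl he) v
      have hwX : w ∉ X i := fun h => hvX (add_mem hx h)
      have hwY : w ∈ X (i + 1) := (Submodule.add_mem_iff_right _ (hle hx)).mp hv
      refine ⟨Function.update b i w, hspan' w hwY hwX, gram_update hs hgram fun j hj => ?_, ?_⟩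
      · rw [hw _ (hbmem i le_rfl j hj), hyperbolicGram, if_neg, if_neg]
        · omega
        · rintro ⟨rfl, h⟩
          exact Nat.not_even_iff_odd.mpr h.add_one he
      · intro k hk hke
        rcases Nat.le_succ_iff.mp hk with hk | rfl
        · exact hev k hk hke
        · exact absurd hke (Nat.not_even_iff_odd.mpr he.add_one)
    · obtain ⟨k, rfl⟩ : ∃ k, i = k + 1 := ⟨i - 1, by have := ho.pos; omega⟩
      have hke : Even k := by
        rcases Nat.even_or_odd k with h | h
        · exact h
        · exact absurd ho (Nat.not_odd_iff_even.mpr h.add_one)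
      have hk0 := hev k (by omega) hke
      have hkle : X k ≤ X (k + 1) := (hX k (by omega)).1
      have hbk : b k ∈ X (k + 1) := hbmem _ le_rfl k (by omega)
      have hsup : X k ⊔ F ∙ b k = X (k + 1) := by
        rw [← hspan k (by omega), ← hspan (k + 1) le_rfl, span_image_Iio_succ]
      have hbperp : ∀ y ∈ X (k + 1), s y (b k) = 0 := by
        intro y hy
        rw [← hspan _ le_rfl] at hy
        induction hy using Submodule.span_induction with
        | mem y hy =>
          obtain ⟨j, hj, rfl⟩ := hy
          rw [Set.mem_Iio] at hj
          rw [hgram j hj k (by omega), hyperbolicGram, if_neg, if_neg]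
          · omega
          · rintro ⟨rfl, h⟩
            exact Nat.not_even_iff_odd.mpr h.add_one hke
        | zero => simp
        | add x y _ _ hx hy => simp [hx, hy]
        | smul a x _ hx => simp [hx]
      have hb0 : b k ≠ 0 := by
        intro h
        rw [h, Submodule.span_zero_singleton, sup_bot_eq] at hsup
        have h1 := hdim k (by omega)
        have h2 := hdim (k + 1) (by omega)
        rw [hsup] at h1
        omega
      obtain ⟨v, hv, hvb⟩ : ∃ v ∈ X (k + 1 + 1), s (b k) v ≠ 0 := by
        by_contra! hcon
        refine hb0 (Submodule.disjoint_def.mp (hX (k + 1) (by omega)).2 _ hbk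
          ⟨hle hbk, fun y hy => form_swap_eq_zero hs (hcon y hy)⟩)
      obtain ⟨x, hx, w₀, hw₀, rfl⟩ := exists_add_mem_orthogonal hs hk0 v
      rw [map_add, form_swap_eq_zero hs (hbperp x (hkle hx)), zero_add] at hvb
      have hw₀Y : w₀ ∈ X (k + 1 + 1) :=
        (Submodule.add_mem_iff_right _ (hle (hkle hx))).mp hv
      obtain ⟨w, hwY, hwX, hbw⟩ : ∃ w ∈ X (k + 1 + 1), (∀ y ∈ X k, s y w = 0) ∧ s (b k) w = 1 :=
        ⟨(s (b k) w₀)⁻¹ • w₀, Submodule.smul_mem _ _ hw₀Y, fun y hy => by simp [hw₀ y hy],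
          by simp [hvb]⟩
      have hwn : w ∉ X (k + 1) := fun h => by
        rw [form_swap_eq_zero hs (hbperp w h)] at hbw
        exact zero_ne_one hbw
      refine ⟨Function.update b (k + 1) w, hspan' w hwY hwn,
        gram_update hs hgram fun j hj => ?_, ?_⟩
      · rcases Nat.lt_succ_iff_lt_or_eq.mp hj with hj | rfl
        · rw [hwX _ (hbmem k (by omega) j hj), hyperbolicGram, if_neg, if_neg]
          · omega
          · omega
        · rw [hbw, hyperbolicGram, if_pos ⟨rfl, hke⟩]
      · intro l hl hle'
        rcases Nat.le_succ_iff.mp hl with hl | rfl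
        · exact hev l hl hle'
        · rw [eq_bot_iff]
          rintro z ⟨hz, hz'⟩
          change z ∈ X (k + 1 + 1) at hz
          change ∀ y ∈ X (k + 1 + 1), s y z = 0 at hz'
          rw [← sup_span_singleton_eq hle hd hwY hwn] at hz
          obtain ⟨z', hz1, y, hy, rfl⟩ := Submodule.mem_sup.mp hz
          obtain ⟨c, rfl⟩ := Submodule.mem_span_singleton.mp hy
          rw [← hsup] at hz1
          obtain ⟨u, hu, y, hy, rfl⟩ := Submodule.mem_sup.mp hz1
          obtain ⟨a, rfl⟩ := Submodule.mem_span_singleton.mp hy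
          have h1 := hz' (b k) (hle hbk)
          rw [map_add, map_add, map_smul, map_smul, hs, hbw,
            form_swap_eq_zero hs (hbperp u (hkle hu))] at h1
          simp only [smul_eq_mul, mul_zero, mul_one, zero_add] at h1
          subst h1
          have h2 := hz' w hwY
          rw [zero_smul, add_zero, map_add, map_smul, form_swap_eq_zero hs (hwX u hu),
            form_swap hs w, hbw] at h2
          have ha : a = 0 := by simpa using h2
          subst ha
          have h3 : u ∈ formRad s (X k) := ⟨hu, fun y hy => by
            have := hz' y (hle (hkle hy))
            simpa using this⟩
          rw [hk0] at h3
          rw [(Submodule.mem_bot F).mp h3]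
          simp

theorem exists_chain_of_isChamber (hdim : 1 ≤ finrank F V) {C : Set (QCTPObject s)}
    (hC : (quasiCTPGeometry s).IsChamber C) :
    ∃ X : ℕ → Submodule F V, X 0 = ⊥ ∧ X (finrank F V) = ⊤ ∧
      (∀ i ≤ finrank F V, finrank F (X i) = i) ∧
      (∀ i < finrank F V, liesIn s (X i) (X (i + 1))) ∧
      ∀ Y : QCTPObject s, Y ∈ C ↔ Y.1 = X (finrank F Y.1) := by
  classical
  have hex : ∀ i, ∃ U : Submodule F V, (i = 0 → U = ⊥) ∧ (i = finrank F V → U = ⊤) ∧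
      (1 ≤ i → i < finrank F V → finrank F U = i ∧ ∃ Y ∈ C, Y.1 = U) := by
    intro i
    by_cases hi : 1 ≤ i ∧ i < finrank F V
    · have : (⟨i, hi⟩ : Set.Ico 1 (finrank F V)) ∈ (quasiCTPGeometry s).flagType C := by
        rw [hC.2]; trivial
      obtain ⟨Y, hY, hYi⟩ := this
      exact ⟨Y.1, by omega, by omega, fun _ _ => ⟨congrArg Subtype.val hYi, Y, hY, rfl⟩⟩
    · by_cases h0 : i = 0
      · exact ⟨⊥, fun _ => rfl, by omega, by omega⟩
      · exact ⟨⊤, by omega, fun _ => rfl, by omega⟩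
  choose X h0 hn hX using hex
  refine ⟨X, h0 0 rfl, hn _ rfl, ?_, ?_, ?_⟩
  · intro i hi
    rcases Nat.eq_zero_or_pos i with h | h
    · rw [h0 i h, finrank_bot, h]
    · rcases hi.eq_or_lt with h' | h'
      · rw [hn i h', finrank_top, h']
      · exact (hX i h h').1
  · intro i hi
    rcases Nat.eq_zero_or_pos i with h | h
    · rw [h0 i h]
      exact ⟨bot_le, disjoint_bot_left⟩
    · obtain ⟨hd, Y, hY, hYX⟩ := hX i h hi
      rcases (Nat.succ_le_iff.mpr hi).eq_or_lt with h' | h'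
      · rw [hn (i + 1) h', ← hYX]
        exact ⟨le_top, Y.2.2.2.1⟩
      · obtain ⟨hd', Z, hZ, hZX⟩ := hX (i + 1) (by omega) h'
        rw [← hYX, ← hZX]
        refine (quasiCTPGeometry_inc.mp (hC.1 Y hY Z hZ)).liesIn_of_lt ?_
        rw [hYX, hZX]; omega
  · intro Y
    obtain ⟨hd, Z, hZ, hZX⟩ := hX (finrank F Y.1) Y.2.1 Y.2.2.1
    constructor
    · intro hY
      have hZY : finrank F Z.1 = finrank F Y.1 := by rw [hZX]; exact hd
      exact (congrArg Subtype.val (hC.1.eq_of_typ_eq hY hZ (Subtype.ext hZY.symm))).trans hZX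
    · intro h
      have : Y = Z := Subtype.ext (h.trans hZX.symm)
      rwa [this]

/-- Bases adapted to the two chambers have the same Gram matrix, so the linear map matching them is
an isometry; it carries initial spans to initial spans. -/
theorem exists_map_eq_of_isChamber (hs : s.IsAlt) (hdim : 1 ≤ finrank F V)
    (C D : Set (QCTPObject s)) (hC : (quasiCTPGeometry s).IsChamber C)
    (hD : (quasiCTPGeometry s).IsChamber D) :
    ∃ g : SpGroup s, (fun X => g • X) '' C = D := by
  obtain ⟨X, hX0, hXn, hXd, hX, hXC⟩ := exists_chain_of_isChamber hdim hC
  obtain ⟨Y, hY0, hYn, hYd, hY, hYD⟩ := exists_chain_of_isChamber hdim hD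
  obtain ⟨b, hb, hbg, -⟩ := exists_adapted_basis hs hX0 hXd hX _ le_rfl
  obtain ⟨c, hc, hcg, -⟩ := exists_adapted_basis hs hY0 hYd hY _ le_rfl
  have hrange : ∀ a : ℕ → V, (Set.range fun i : Fin (finrank F V) => a i) =
      a '' Set.Iio (finrank F V) := by
    intro a
    ext x
    constructor
    · rintro ⟨i, rfl⟩
      exact ⟨i, i.2, rfl⟩
    · rintro ⟨i, hi, rfl⟩
      exact ⟨⟨i, hi⟩, rfl⟩
  let B := basisOfTopLeSpanOfCardEqFinrank (fun i : Fin (finrank F V) => b i)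
    (by rw [hrange, hb _ le_rfl, hXn]) (by simp)
  let B' := basisOfTopLeSpanOfCardEqFinrank (fun i : Fin (finrank F V) => c i)
    (by rw [hrange, hc _ le_rfl, hYn]) (by simp)
  let g : V ≃ₗ[F] V := B.equiv B' (Equiv.refl _)
  have hB : ∀ i, B i = b i := fun i => by simp [B]
  have hgb : ∀ i < finrank F V, g (b i) = c i := by
    intro i hi
    have h1 := B.equiv_apply ⟨i, hi⟩ B' (Equiv.refl _)
    rw [hB] at h1
    simpa [B'] using h1
  have hg : g ∈ SpGroup s := by
    have h2 : s.compl₁₂ g.toLinearMap g.toLinearMap = s := by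
      refine B.ext fun i => B.ext fun j => ?_
      rw [hB, hB]
      simp only [LinearMap.compl₁₂_apply, LinearEquiv.coe_coe]
      rw [hgb i i.2, hgb j j.2, hbg i i.2 j j.2, hcg i i.2 j j.2]
    intro x y
    exact LinearMap.congr_fun₂ h2 x y
  have hmap : ∀ i ≤ finrank F V, (X i).map g.toLinearMap = Y i := by
    intro i hi
    rw [← hb i hi, ← hc i hi, Submodule.map_span, ← Set.image_comp]
    congr 1
    exact Set.image_congr fun j hj => hgb j (lt_of_lt_of_le hj hi)
  refine ⟨⟨g, hg⟩, Set.ext fun Z => ⟨?_, fun hZ => ?_⟩⟩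
  · rintro ⟨W, hW, rfl⟩
    rw [hYD]
    change W.1.map g.toLinearMap = Y (finrank F (W.1.map g.toLinearMap))
    rw [finrank_map_equiv, ← hmap _ W.2.2.1.le]
    exact congrArg _ ((hXC W).mp hW)
  · refine ⟨(⟨g, hg⟩ : SpGroup s)⁻¹ • Z, ?_, smul_inv_smul _ _⟩
    set W := (⟨g, hg⟩ : SpGroup s)⁻¹ • Z with hW
    have e : W.1.map g.toLinearMap = Z.1 := by
      have : (⟨g, hg⟩ : SpGroup s) • W = Z := smul_inv_smul _ _
      exact congrArg Subtype.val this
    rw [hXC]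
    refine Submodule.map_injective_of_injective (f := g.toLinearMap) g.injective ?_
    have hd : finrank F W.1 = finrank F Z.1 := by rw [← e, finrank_map_equiv]
    rw [hmap _ W.2.2.1.le, e, hd]
    exact (hYD Z).mp hZ

end Symplectic

/-! ### The non-orthogonality graph and its triangles -/

section Symplectic

variable {F : Type u} {V : Type v} [Field F] [AddCommGroup V] [Module F V]
  {s : LinearMap.BilinForm F V}

theorem notMem_formRad_top (hs : s.IsAlt) {v w : V} (h : s v w ≠ 0) : v ∉ formRad s ⊤ :=
  fun hv => form_swap_ne_zero hs h (hv.2 w trivial)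

theorem exists_form_ne_zero (hs : s.IsAlt) {v : V} (h : v ∉ formRad s ⊤) : ∃ w, s v w ≠ 0 := by
  by_contra! hcon
  exact h ⟨trivial, fun y _ => form_swap_eq_zero hs (hcon y)⟩

/-- Two vectors outside the radical of `W` have a common non-orthogonal vector in `W`. -/
theorem exists_form_ne_zero_and (hs : s.IsAlt) {W : Submodule F V} {v w : V}
    (hv : ∃ x ∈ W, s v x ≠ 0) (hw : ∃ x ∈ W, s w x ≠ 0) :
    ∃ x ∈ W, s v x ≠ 0 ∧ s x w ≠ 0 := by
  obtain ⟨x, hx, hvx⟩ := hv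
  obtain ⟨y, hy, hwy⟩ := hw
  by_cases h1 : s w x = 0
  · by_cases h2 : s v y = 0
    · refine ⟨x + y, add_mem hx hy, by simpa [h2] using hvx, form_swap_ne_zero hs ?_⟩
      simpa [h1] using hwy
    · exact ⟨y, hy, h2, form_swap_ne_zero hs hwy⟩
  · exact ⟨x, hx, hvx, form_swap_ne_zero hs h1⟩

/-- A cocycle on the non-orthogonality graph that is trivial on triangles has a potential. -/
theorem exists_potential (hs : s.IsAlt) {H : Type*} [Group H] {d : V → V → H}
    (hinv : ∀ v w, s v w ≠ 0 → d v w * d w v = 1)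
    (htri : ∀ u v w, s u v ≠ 0 → s v w ≠ 0 → s u w ≠ 0 → d u v * d v w = d u w) :
    ∃ f : V → H, ∀ v w, s v w ≠ 0 → f v * d v w = f w := by
  classical
  by_cases hp : ∃ p, p ∉ formRad s ⊤
  swap
  · push Not at hp
    exact ⟨fun _ => 1, fun v w h => absurd (hp v) (notMem_formRad_top hs h)⟩
  obtain ⟨p, hp⟩ := hp
  have hex : ∀ q, q ∉ formRad s ⊤ → ∃ r, s p r ≠ 0 ∧ s r q ≠ 0 := by
    intro q hq
    obtain ⟨x, hx⟩ := exists_form_ne_zero hs hp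
    obtain ⟨y, hy⟩ := exists_form_ne_zero hs hq
    obtain ⟨r, -, hr⟩ := exists_form_ne_zero_and (W := ⊤) hs ⟨x, trivial, hx⟩ ⟨y, trivial, hy⟩
    exact ⟨r, hr⟩
  have hind₀ : ∀ q r r', s p r ≠ 0 → s r q ≠ 0 → s p r' ≠ 0 → s r' q ≠ 0 → s r r' ≠ 0 →
      d p r * d r q = d p r' * d r' q := by
    intro q r r' h1 h2 h3 h4 h5
    rw [← htri p r r' h1 h5 h3, mul_assoc, htri r r' q h5 h4 h2]
  have hind : ∀ q r r', s p r ≠ 0 → s r q ≠ 0 → s p r' ≠ 0 → s r' q ≠ 0 →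
      d p r * d r q = d p r' * d r' q := by
    intro q r r' h1 h2 h3 h4
    by_cases hpq : s p q = 0
    · by_cases hrr : s r r' = 0
      -- Both diagonals of the quadrangle `p, r, q, r'` are orthogonal pairs; `p + r` is adjacent to
      -- all four vertices.
      · have k1 : s p (p + r) ≠ 0 := by simpa [hs p] using h1
        have k2 : s (p + r) q ≠ 0 := by simpa [hpq] using h2
        have k3 : s r (p + r) ≠ 0 := by simpa [hs r] using form_swap_ne_zero hs h1
        have k4 : s (p + r) r' ≠ 0 := by simpa [hrr] using h3
        rw [hind₀ q r (p + r) h1 h2 k1 k2 k3, hind₀ q (p + r) r' k1 k2 h3 h4 k4]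
      · exact hind₀ q r r' h1 h2 h3 h4 hrr
    · rw [htri p r q h1 h2 hpq, htri p r' q h3 h4 hpq]
  let f : V → H := fun q => if h : q ∉ formRad s ⊤ then
    d p (hex q h).choose * d (hex q h).choose q else 1
  have hf : ∀ q r, s p r ≠ 0 → s r q ≠ 0 → f q = d p r * d r q := by
    intro q r h1 h2
    have hq : q ∉ formRad s ⊤ := notMem_formRad_top hs (form_swap_ne_zero hs h2)
    have hr := (hex q hq).choose_spec
    simp only [f, dif_pos hq]
    exact hind q _ r hr.1 hr.2 h1 h2
  have hf' : ∀ q, s p q ≠ 0 → f q = d p q := by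
    intro q h
    obtain ⟨r, h1, h2⟩ := hex q (notMem_formRad_top hs (form_swap_ne_zero hs h))
    rw [hf q r h1 h2, htri p r q h1 h2 h]
  have hf1 : ∀ v w, s v w ≠ 0 → s p v ≠ 0 → f v * d v w = f w := by
    intro v w h hv
    rw [hf' v hv, hf w v hv h]
  refine ⟨f, fun v w h => ?_⟩
  by_cases hv : s p v = 0
  · by_cases hw : s p w = 0
    · obtain ⟨x, hx⟩ := exists_form_ne_zero hs hp
      -- The pentagon case: `v` and `w` are both orthogonal to `p`. Adding multiples of them to `x`
      -- leaves its product with `p` unchanged, and the coefficients are solved so that `s v r = s w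
      -- r = 1`.
      obtain ⟨r, h1, h2, h3⟩ : ∃ r, s p r ≠ 0 ∧ s v r ≠ 0 ∧ s w r ≠ 0 := by
        have hwv := form_swap_ne_zero hs h
        refine ⟨x + ((1 - s w x) / s w v) • v + ((1 - s v x) / s v w) • w, ?_, ?_, ?_⟩
        · simpa [hv, hw] using hx
        · have : s v (x + ((1 - s w x) / s w v) • v + ((1 - s v x) / s v w) • w) = 1 := by
            simp [hs v, h]
          rw [this]; exact one_ne_zero
        · have : s w (x + ((1 - s w x) / s w v) • v + ((1 - s v x) / s v w) • w) = 1 := by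
            simp [hs w, hwv]
          rw [this]; exact one_ne_zero
      have h2' := form_swap_ne_zero hs h2
      have h3' := form_swap_ne_zero hs h3
      rw [hf v r h1 h2', hf w r h1 h3', mul_assoc, htri r v w h2' h h3']
    · rw [← hf1 w v (form_swap_ne_zero hs h) hw, mul_assoc, hinv w v (form_swap_ne_zero hs h),
        mul_one]
  · exact hf1 v w h hv

theorem coeffs_of_mem_formRad (hs : s.IsAlt) {x y n : V} (hxy : s x y ≠ 0) (hx : s x n = 0)
    (hy : s y n = 0) {a b : F} (h : a • x + b • y + n ∈ formRad s ⊤) :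
    a = 0 ∧ b = 0 ∧ n ∈ formRad s ⊤ := by
  have h1 := h.2 x trivial
  have h2 := h.2 y trivial
  have hyx := form_swap_ne_zero hs hxy
  simp only [map_add, map_smul, hs x, hs y, hx, hy, smul_eq_mul, mul_zero, zero_add,
    add_zero, mul_eq_zero, hxy, hyx, or_false] at h1 h2
  subst h1 h2
  simpa using h

/-- The span of `u, v, w` meets the radical of `V` trivially. -/
def SpanAvoidsRad (s : LinearMap.BilinForm F V) (u v w : V) : Prop :=
  ∀ a b c : F, a • u + b • v + c • w ∈ formRad s ⊤ → a • u + b • v + c • w = 0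

/-- The vertex `q = x - t • y + m` is adjacent to x, y and z = e - x - y, because its products with
them are nonzero multiples of `s x y` when t ≠ 0, -1. Its component m, which is not in Rad(V), keeps
the spans of xqy, yqz and xqz away from Rad(V), and these three triangles fill xyz. -/
theorem triangle_of_third_point (hs : s.IsAlt) {H : Type*} [Group H] {d : V → V → H}
    (hinv : ∀ v w, s v w ≠ 0 → d v w * d w v = 1)
    (hgood : ∀ u v w, s u v ≠ 0 → s v w ≠ 0 → s u w ≠ 0 → SpanAvoidsRad s u v w →
      d u v * d v w = d u w)
    {x y e m : V} (hxy : s x y ≠ 0) (he : e ∈ formRad s ⊤) (hxm : s x m = 0) (hym : s y m = 0)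
    (hm : m ∉ formRad s ⊤) {t : F} (ht0 : t ≠ 0) (ht1 : t + 1 ≠ 0) :
    d x y * d y (e - x - y) = d x (e - x - y) := by
  have hxe : ∀ z, s z e = 0 := fun z => he.2 z trivial
  have hex : ∀ z, s e z = 0 := fun z => form_swap_eq_zero hs (hxe z)
  have hyx : s y x = -s x y := form_swap hs y x
  have hmx : s m x = 0 := form_swap_eq_zero hs hxm
  have hmy : s m y = 0 := form_swap_eq_zero hs hym
  set q := x - t • y + m with hq
  have hxq : s x q = -(t * s x y) := by simp [hq, hs x, hxm]
  have hyq : s y q = - s x y := by simp [hq, hs y, hym, hyx]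
  have hqz : s q (e - x - y) = -((t + 1) * s x y) := by
    simp [hq, hs x, hs y, hmx, hmy, hxe, hyx]; ring
  have hkey : ∀ a b c f : F, a • x + b • y + (c • m + f • e) ∈ formRad s ⊤ →
      a = 0 ∧ b = 0 ∧ c = 0 := by
    intro a b c f h
    obtain ⟨h1, h2, h3⟩ := coeffs_of_mem_formRad hs hxy (by simp [hxm, hxe])
      (by simp [hym, hxe]) h
    refine ⟨h1, h2, by_contra fun hc => hm ?_⟩
    exact (Submodule.smul_mem_iff _ hc).mp
      ((Submodule.add_mem_iff_left _ (Submodule.smul_mem _ f he)).mp h3)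
  have hxq0 : s x q ≠ 0 := by rw [hxq]; exact neg_ne_zero.mpr (mul_ne_zero ht0 hxy)
  have hyq0 : s y q ≠ 0 := by rw [hyq]; exact neg_ne_zero.mpr hxy
  have hqz0 : s q (e - x - y) ≠ 0 := by rw [hqz]; exact neg_ne_zero.mpr (mul_ne_zero ht1 hxy)
  have hxz0 : s x (e - x - y) ≠ 0 := by simpa [hs x, hxe] using hxy
  have hyz0 : s y (e - x - y) ≠ 0 := by simpa [hs y, hxe, hyx] using hxy
  have e1 : d x q * d q y = d x y := by
    refine hgood _ _ _ hxq0 (form_swap_ne_zero hs hyq0) hxy fun a b c h => ?_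
    have e0 : a • x + b • q + c • y = (a + b) • x + (c - b * t) • y + (b • m + (0 : F) • e) := by
      rw [hq]; module
    obtain ⟨h1, h2, h3⟩ := hkey _ _ _ _ (e0 ▸ h)
    rw [e0, h1, h2, h3]; module
  have e2 : d y q * d q (e - x - y) = d y (e - x - y) := by
    refine hgood _ _ _ hyq0 hqz0 hyz0 fun a b c h => ?_
    have e0 : a • y + b • q + c • (e - x - y) =
        (b - c) • x + (a - b * t - c) • y + (b • m + c • e) := by rw [hq]; module
    obtain ⟨h1, h2, h3⟩ := hkey _ _ _ _ (e0 ▸ h)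
    have hc : c = 0 := by rw [h3] at h1; simpa using h1
    rw [e0, h1, h2, h3, hc]; module
  have e3 : d x q * d q (e - x - y) = d x (e - x - y) := by
    refine hgood _ _ _ hxq0 hqz0 hxz0 fun a b c h => ?_
    have e0 : a • x + b • q + c • (e - x - y) =
        (a + b - c) • x + (- (b * t) - c) • y + (b • m + c • e) := by rw [hq]; module
    obtain ⟨h1, h2, h3⟩ := hkey _ _ _ _ (e0 ▸ h)
    have hc : c = 0 := by rw [h3] at h2; simpa using h2
    rw [e0, h1, h2, h3, hc]; module
  rw [← e1, ← e2, ← e3, mul_assoc, ← mul_assoc (d q y), hinv q y (form_swap_ne_zero hs hyq0),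
    one_mul]

/-- With z = e - x - y, the vertices x, y, z and p = x + m, q = y + n, r = -x - y form an octahedron
with opposite pairs x–p, y–q, z–r. Every edge has form value `± s x y`, so this works over any
field. The seven faces other than xyz have spans avoiding Rad(V), and their relations compose to the
one for xyz. -/
theorem triangle_of_octahedron (hs : s.IsAlt) {H : Type*} [Group H] {d : V → V → H}
    (hinv : ∀ v w, s v w ≠ 0 → d v w * d w v = 1)
    (hgood : ∀ u v w, s u v ≠ 0 → s v w ≠ 0 → s u w ≠ 0 → SpanAvoidsRad s u v w →
      d u v * d v w = d u w)
    {x y e m n : V} (hxy : s x y ≠ 0) (he : e ∈ formRad s ⊤) (hxm : s x m = 0) (hym : s y m = 0)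
    (hxn : s x n = 0) (hyn : s y n = 0) (hmn : s m n = 0)
    (hind : ∀ a b : F, a • m + b • n ∈ formRad s ⊤ → a = 0 ∧ b = 0) :
    d x y * d y (e - x - y) = d x (e - x - y) := by
  have hxe : ∀ z, s z e = 0 := fun z => he.2 z trivial
  have hex : ∀ z, s e z = 0 := fun z => form_swap_eq_zero hs (hxe z)
  have hyx : s y x = -s x y := form_swap hs y x
  have hmx : s m x = 0 := form_swap_eq_zero hs hxm
  have hmy : s m y = 0 := form_swap_eq_zero hs hym
  have hnx : s n x = 0 := form_swap_eq_zero hs hxn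
  have hny : s n y = 0 := form_swap_eq_zero hs hyn
  have hnm : s n m = 0 := form_swap_eq_zero hs hmn
  -- Since x, y, m, n are independent modulo Rad(V), a radical combination has only its `e`-term
  -- left; the side condition says that the coefficient of `e` vanishes along with the others.
  have hkey : ∀ a b c f g : F, (a = 0 → b = 0 → c = 0 → f = 0 → g = 0) →
      ∀ z, z = a • x + b • y + (c • m + f • n + g • e) → z ∈ formRad s ⊤ → z = 0 := by
    rintro a b c f g hg z rfl h
    obtain ⟨h1, h2, h3⟩ := coeffs_of_mem_formRad hs hxy (by simp [hxm, hxn, hxe])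
      (by simp [hym, hyn, hxe]) h
    obtain ⟨h4, h5⟩ := hind c f
      ((Submodule.add_mem_iff_left _ (Submodule.smul_mem _ g he)).mp h3)
    rw [h1, h2, h4, h5, hg h1 h2 h4 h5]; module
  have hpts : ∀ u v : V, (s u v = s x y ∨ s u v = -s x y) → s u v ≠ 0 := by
    rintro u v (h | h) <;> rw [h]
    · exact hxy
    · exact neg_ne_zero.mpr hxy
  set z := e - x - y with hz
  set p := x + m with hp
  set q := y + n with hq
  set r := -x - y with hr
  have e1 : d x r * d r y = d x y := by
    refine hgood _ _ _ (hpts _ _ ?_) (hpts _ _ ?_) (hpts _ _ ?_) fun a b c h =>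
      hkey (a - b) (c - b) 0 0 0 (by simp) _ (by rw [hr]; module) h <;>
    simp [hr, hs x, hs y]
  have e2 : d y p * d p z = d y z := by
    refine hgood _ _ _ (hpts _ _ ?_) (hpts _ _ ?_) (hpts _ _ ?_) fun a b c h =>
      hkey (b - c) (a - c) b 0 c (fun h1 _ h2 _ => by rw [h2] at h1; simpa using h1) _
        (by rw [hp, hz]; module) h <;>
    simp [hp, hz, hs x, hs y, hyx, hxe, hym, hmx, hmy]
  have e3 : d x q * d q z = d x z := by
    refine hgood _ _ _ (hpts _ _ ?_) (hpts _ _ ?_) (hpts _ _ ?_) fun a b c h =>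
      hkey (a - c) (b - c) 0 b c (fun _ h1 _ h2 => by rw [h2] at h1; simpa using h1) _
        (by rw [hq, hz]; module) h <;>
    simp [hq, hz, hs x, hs y, hyx, hxe, hxn, hnx, hny]
  have e4 : d x q * d q r = d x r := by
    refine hgood _ _ _ (hpts _ _ ?_) (hpts _ _ ?_) (hpts _ _ ?_) fun a b c h =>
      hkey (a - c) (b - c) 0 b 0 (by simp) _ (by rw [hq, hr]; module) h <;>
    simp [hq, hr, hs x, hs y, hyx, hxn, hnx, hny]
  have e5 : d r p * d p y = d r y := by
    refine hgood _ _ _ (hpts _ _ ?_) (hpts _ _ ?_) (hpts _ _ ?_) fun a b c h =>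
      hkey (b - a) (c - a) b 0 0 (by simp) _ (by rw [hp, hr]; module) h <;>
    simp [hp, hr, hs x, hs y, hyx, hxm, hym, hmy]
  have e6 : d q r * d r p = d q p := by
    refine hgood _ _ _ (hpts _ _ ?_) (hpts _ _ ?_) (hpts _ _ ?_) fun a b c h =>
      hkey (c - b) (a - b) c a 0 (by simp) _ (by rw [hp, hq, hr]; module) h <;>
    simp [hp, hq, hr, hs x, hs y, hyx, hxm, hym, hnx, hny, hnm]
  have e7 : d q p * d p z = d q z := by
    refine hgood _ _ _ (hpts _ _ ?_) (hpts _ _ ?_) (hpts _ _ ?_) fun a b c h =>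
      hkey (b - c) (a - c) b a c (fun h1 _ h2 _ => by rw [h2] at h1; simpa using h1) _
        (by rw [hp, hq, hz]; module) h <;>
    simp [hp, hq, hz, hs x, hs y, hyx, hxe, hym, hmx, hmy, hnx, hny, hnm]
  have hyp : s y p ≠ 0 := hpts _ _ (by simp [hp, hyx, hym])
  calc d x y * d y z = d x q * (d q r * d r p) * (d p y * d y p) * d p z := by
        rw [← e1, ← e2, ← e4, ← e5]; group
    _ = d x q * (d q p * d p z) := by
        rw [hinv p y (form_swap_ne_zero hs hyp), e6]; group
    _ = d x z := by rw [e7, e3]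

variable [FiniteDimensional F V]

theorem formRad_sup_hyperbolic (hs : s.IsAlt) {X : Submodule F V} (hX : formRad s X = ⊥) {v w : V}
    (hv : ∀ x ∈ X, s x v = 0) (hw : ∀ x ∈ X, s x w = 0) (hvw : s v w ≠ 0) :
    formRad s (X ⊔ F ∙ v ⊔ F ∙ w) = ⊥ ∧
      finrank F (X ⊔ F ∙ v ⊔ F ∙ w : Submodule F V) = finrank F X + 2 := by
  have hX0 : ∀ x ∈ X, (∀ y ∈ X, s y x = 0) → x = 0 := fun x hx hy => by
    have : x ∈ formRad s X := ⟨hx, hy⟩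
    rwa [hX] at this
  have hvX : v ∉ X := fun h => by
    rw [hX0 v h hv] at hvw
    simp at hvw
  have hwX : w ∉ X ⊔ F ∙ v := fun h => by
    obtain ⟨x, hx, y, hy, rfl⟩ := Submodule.mem_sup.mp h
    obtain ⟨a, rfl⟩ := Submodule.mem_span_singleton.mp hy
    rw [map_add, map_smul, hs, smul_zero, add_zero, form_swap_eq_zero hs (hv x hx)] at hvw
    exact hvw rfl
  refine ⟨?_, by rw [finrank_sup_span_singleton hwX, finrank_sup_span_singleton hvX]⟩
  rw [eq_bot_iff]
  rintro z ⟨hz, hz'⟩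
  obtain ⟨z', hz1, y, hy, rfl⟩ := Submodule.mem_sup.mp hz
  obtain ⟨c, rfl⟩ := Submodule.mem_span_singleton.mp hy
  obtain ⟨u, hu, y, hy, rfl⟩ := Submodule.mem_sup.mp hz1
  obtain ⟨a, rfl⟩ := Submodule.mem_span_singleton.mp hy
  have hvm : v ∈ X ⊔ F ∙ v ⊔ F ∙ w := Submodule.mem_sup_left
    (Submodule.mem_sup_right (Submodule.mem_span_singleton_self v))
  have hwm : w ∈ X ⊔ F ∙ v ⊔ F ∙ w := Submodule.mem_sup_right (Submodule.mem_span_singleton_self w)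
  have h1 := hz' v hvm
  have h2 := hz' w hwm
  have hwv := form_swap_ne_zero hs hvw
  simp only [map_add, map_smul, hs v, hs w, form_swap_eq_zero hs (hv u hu),
    form_swap_eq_zero hs (hw u hu), smul_eq_mul, mul_zero, zero_add,
    add_zero, mul_eq_zero, hvw, hwv, or_false] at h1 h2
  subst h1 h2
  have h3 := hX0 u hu fun y hy => by
    simpa using hz' y (Submodule.mem_sup_left (Submodule.mem_sup_left hy))
  simp [h3]

theorem formRad_span_pair (hs : s.IsAlt) {v w : V} (hvw : s v w ≠ 0) :
    formRad s (Submodule.span F {v, w}) = ⊥ ∧ finrank F (Submodule.span F {v, w}) = 2 := by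
  have h := formRad_sup_hyperbolic hs (X := ⊥) (v := v) (w := w)
    (eq_bot_iff.mpr (formRad_le _)) (by simp) (by simp) hvw
  rw [bot_sup_eq, ← Submodule.span_insert, finrank_bot] at h
  exact h

/-- A nondegenerate subspace of small dimension has a non-radical orthogonal vector. -/
theorem exists_orthogonal_notMem_formRad (hs : s.IsAlt) {X : Submodule F V}
    (hX : formRad s X = ⊥) (h : finrank F X + finrank F (formRad s ⊤) < finrank F V) :
    ∃ m, (∀ x ∈ X, s x m = 0) ∧ m ∉ formRad s ⊤ := by
  by_contra! hcon
  have hle : (⊤ : Submodule F V) ≤ X ⊔ formRad s ⊤ := by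
    intro v _
    obtain ⟨x, hx, w, hw, rfl⟩ := exists_add_mem_orthogonal hs hX v
    exact Submodule.add_mem_sup hx (hcon w hw)
  have h1 := Submodule.finrank_mono hle
  have h2 := Submodule.finrank_add_le_finrank_add_finrank X (formRad s ⊤)
  rw [finrank_top] at h1
  omega

theorem card_eq_two_of_forall (h : ∀ t : F, t = 0 ∨ t + 1 = 0) : Nat.card F = 2 := by
  have h1 : ∀ t : F, t = 0 ∨ t = -1 := fun t => (h t).imp id eq_neg_of_add_eq_zero_left
  rw [Nat.card_eq_two_iff]
  exact ⟨0, -1, (neg_ne_zero.mpr one_ne_zero).symm, Set.eq_univ_of_forall fun t => h1 t⟩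

/-- If the span contains a nonzero radical vector e = au + bv + cw, pairing e with u, v, w forces a,
b, c all nonzero. Scaling the vertices, which does not affect `d`, brings the triangle to the form
x, y, e - x - y treated by the two fillings. -/
theorem triangle_of_spanAvoidsRad (hs : s.IsAlt) (hrad : finrank F (formRad s ⊤) ≤ 1)
    (hdim : 4 ≤ finrank F V) (hexc : ¬ (finrank F V = 5 ∧ Nat.card F = 2))
    {H : Type*} [Group H] {d : V → V → H}
    (hinv : ∀ v w, s v w ≠ 0 → d v w * d w v = 1)
    (hscale : ∀ v w (a b : F), s v w ≠ 0 → a ≠ 0 → b ≠ 0 → d (a • v) (b • w) = d v w)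
    (hgood : ∀ u v w, s u v ≠ 0 → s v w ≠ 0 → s u w ≠ 0 → SpanAvoidsRad s u v w →
      d u v * d v w = d u w)
    (u v w : V) (huv : s u v ≠ 0) (hvw : s v w ≠ 0) (huw : s u w ≠ 0) :
    d u v * d v w = d u w := by
  by_cases hav : SpanAvoidsRad s u v w
  · exact hgood u v w huv hvw huw hav
  simp only [SpanAvoidsRad, not_forall] at hav
  obtain ⟨a, b, c, he, he0⟩ := hav
  set e := a • u + b • v + c • w with hedef
  have hvu := form_swap_ne_zero hs huv
  have hwv := form_swap_ne_zero hs hvw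
  have hwu := form_swap_ne_zero hs huw
  have h1 := he.2 u trivial
  have h2 := he.2 v trivial
  have h3 := he.2 w trivial
  simp only [hedef, map_add, map_smul, hs u, hs v, hs w, smul_eq_mul, mul_zero, zero_add,
    add_zero] at h1 h2 h3
  have ha : a ≠ 0 := by
    rintro rfl
    have hc : c = 0 := by simpa [hvw] using h2
    have hb : b = 0 := by simpa [hwv] using h3
    exact he0 (by rw [hedef, hb, hc]; simp)
  have hb : b ≠ 0 := by
    rintro rfl
    have hc : c = 0 := by simpa [huw] using h1
    exact ha (by simpa [hc, hvu] using h2)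
  have hc : c ≠ 0 := by
    rintro rfl
    exact hb (by simpa [huv] using h1)
  have hw : c • w = e - a • u - b • v := by rw [hedef]; module
  have hxy : s (a • u) (b • v) ≠ 0 := by simp [ha, hb, huv]
  rw [← hscale u v a b huv ha hb, ← hscale v w b c hvw hb hc, ← hscale u w a c huw ha hc, hw]
  generalize a • u = x at hxy
  generalize b • v = y at hxy
  obtain ⟨hL, hLd⟩ := formRad_span_pair hs hxy
  have hxL : x ∈ Submodule.span F {x, y} := Submodule.subset_span (by simp)
  have hyL : y ∈ Submodule.span F {x, y} := Submodule.subset_span (by simp)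
  obtain ⟨m, hLm, hm⟩ := exists_orthogonal_notMem_formRad hs hL (by omega)
  by_cases ht : ∃ t : F, t ≠ 0 ∧ t + 1 ≠ 0
  · obtain ⟨t, ht0, ht1⟩ := ht
    exact triangle_of_third_point hs hinv hgood hxy he (hLm x hxL) (hLm y hyL) hm ht0 ht1
  · have hcard : Nat.card F = 2 := card_eq_two_of_forall (by
      intro t
      by_contra! hcon
      exact ht ⟨t, hcon⟩)
    obtain ⟨z₀, hz₀⟩ := exists_form_ne_zero hs hm
    obtain ⟨l, hl, z, hLz, rfl⟩ := exists_add_mem_orthogonal hs hL z₀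
    rw [map_add, form_swap_eq_zero hs (hLm l hl), zero_add] at hz₀
    obtain ⟨hL', hLd'⟩ := formRad_sup_hyperbolic hs hL hLm hLz hz₀
    set L' := Submodule.span F {x, y} ⊔ F ∙ m ⊔ F ∙ z
    -- The four-dimensional `L'` is nondegenerate, so n = 4 would exclude `e`. As n = 5 is excluded
    -- too, V is larger than `L'` + Rad(V) and has room for the second vector `n`.
    have hne : finrank F V ≠ 4 := fun h => by
      have htop : L' = ⊤ := Submodule.eq_top_of_finrank_eq (by omega)
      rw [← htop, hL'] at he
      exact he0 he
    obtain ⟨n, hLn, hn⟩ := exists_orthogonal_notMem_formRad hs hL' (by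
      have : finrank F V ≠ 5 := fun h => hexc ⟨h, hcard⟩
      omega)
    have hLL : Submodule.span F {x, y} ≤ L' := le_sup_left.trans le_sup_left
    have hmL : m ∈ L' := Submodule.mem_sup_left
      (Submodule.mem_sup_right (Submodule.mem_span_singleton_self m))
    have hzL : z ∈ L' := Submodule.mem_sup_right (Submodule.mem_span_singleton_self z)
    refine triangle_of_octahedron hs hinv hgood hxy he (hLm x hxL) (hLm y hyL)
      (hLn x (hLL hxL)) (hLn y (hLL hyL)) (hLn m hmL) fun a' b' h => ?_
    have h4 := h.2 z trivial
    have hzm := form_swap_ne_zero hs hz₀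
    simp only [map_add, map_smul, hLn z hzL, smul_eq_mul, mul_zero, add_zero, mul_eq_zero, hzm,
      or_false] at h4
    subst h4
    refine ⟨rfl, by_contra fun hb' => hn ?_⟩
    rw [zero_smul, zero_add] at h
    exact (Submodule.smul_mem_iff _ hb').mp h

end Symplectic

/-! ### Connectedness and triviality of cocycles -/

section Symplectic

variable {F : Type u} {V : Type v} [Field F] [AddCommGroup V] [Module F V]
  {s : LinearMap.BilinForm F V}

variable (s) in
/-- The subspaces that are objects of the geometry. -/
def IsQCTPObject (U : Submodule F V) : Prop :=
  1 ≤ finrank F U ∧ finrank F U < finrank F V ∧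
    Disjoint U (formRad s ⊤) ∧ finrank F (formRad s U) ≤ 1

theorem liesIn_span_singleton {U : Submodule F V} {v x : V} (hv : v ∈ U) (hx : x ∈ U)
    (h : s x v ≠ 0) : liesIn s (F ∙ v) U := by
  refine ⟨(Submodule.span_singleton_le_iff_mem _ _).mpr hv, ?_⟩
  refine Submodule.disjoint_def.mpr fun z hz hzU => ?_
  obtain ⟨a, rfl⟩ := Submodule.mem_span_singleton.mp hz
  have h1 := hzU.2 x hx
  rw [map_smul, smul_eq_mul] at h1
  rw [(mul_eq_zero.mp h1).resolve_right h, zero_smul]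

theorem liesIn_top_of_notMem {v : V} (hv : v ∉ formRad s ⊤) : liesIn s (F ∙ v) ⊤ := by
  have : ∃ x, s x v ≠ 0 := by
    by_contra! hcon
    exact hv ⟨trivial, fun x _ => hcon x⟩
  obtain ⟨x, hx⟩ := this
  exact liesIn_span_singleton trivial trivial hx

theorem isQCTPObject_span_singleton (hdim : 4 ≤ finrank F V) {v : V} (hv : v ∉ formRad s ⊤) :
    IsQCTPObject s (F ∙ v) := by
  have h0 : v ≠ 0 := fun h => hv (by rw [h]; exact zero_mem _)
  have h1 := finrank_span_singleton (K := F) h0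
  exact ⟨h1.ge, by omega, (liesIn_top_of_notMem hv).2,
    (Submodule.finrank_mono (formRad_le _)).trans h1.le⟩

variable (s) in
/-- A cocycle on the flags of the geometry, as a function of pairs of subspaces. -/
def IsSubspaceCocycle {H : Type*} [Group H] (c : Submodule F V → Submodule F V → H) : Prop :=
  ∀ X Y Z, IsQCTPObject s X → IsQCTPObject s Y → IsQCTPObject s Z →
    SubspaceInc s X Y → SubspaceInc s Y Z → SubspaceInc s X Z → c X Y * c Y Z = c X Z

namespace IsSubspaceCocycle

variable {H : Type*} [Group H] {c : Submodule F V → Submodule F V → H}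

theorem self (hc : IsSubspaceCocycle s c) {X : Submodule F V} (hX : IsQCTPObject s X) :
    c X X = 1 :=
  mul_eq_left.mp (hc X X X hX hX hX (Or.inl rfl) (Or.inl rfl) (Or.inl rfl))

theorem symm (hc : IsSubspaceCocycle s c) {X Y : Submodule F V} (hX : IsQCTPObject s X)
    (hY : IsQCTPObject s Y) (h : SubspaceInc s X Y) : c X Y * c Y X = 1 := by
  rw [hc X Y X hX hY hX h h.symm (Or.inl rfl), hc.self hX]

end IsSubspaceCocycle

variable [FiniteDimensional F V]

theorem isQCTPObject_span_pair (hs : s.IsAlt) (hdim : 4 ≤ finrank F V) {v w : V}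
    (h : s v w ≠ 0) : IsQCTPObject s (Submodule.span F {v, w}) := by
  obtain ⟨h1, h2⟩ := formRad_span_pair hs h
  refine ⟨by omega, by omega, (liesIn_of_formRad_eq_bot le_top h1).2, ?_⟩
  rw [h1, finrank_bot]
  exact zero_le_one

/-- The hyperbolic plane spanned by u and v meets the radical of the span trivially, so that radical
has dimension at most 3 - 2 = 1. -/
theorem isQCTPObject_span_triple (hs : s.IsAlt) (hdim : 4 ≤ finrank F V) {u v w : V}
    (huv : s u v ≠ 0) (hav : SpanAvoidsRad s u v w) :
    IsQCTPObject s (Submodule.span F {u, v, w}) := by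
  obtain ⟨h1, h2⟩ := formRad_span_pair hs huv
  have hle : Submodule.span F {u, v} ≤ Submodule.span F {u, v, w} :=
    Submodule.span_mono (by intro x; simp; tauto)
  have h3 : finrank F (Submodule.span F {u, v, w}) ≤ 3 := by
    classical
    exact (finrank_span_le_card _).trans (by
      simpa using Finset.card_le_three (a := u) (b := v) (c := w))
  have h4 := Submodule.finrank_mono hle
  refine ⟨by omega, by omega, Submodule.disjoint_def.mpr fun x hx hxr => ?_, ?_⟩
  · obtain ⟨a, b, c, rfl⟩ := Submodule.mem_span_triple.mp hx
    exact hav a b c hxr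
  · have hd := (liesIn_of_formRad_eq_bot hle h1).2
    have h5 := Submodule.finrank_sup_add_finrank_inf_eq (Submodule.span F {u, v})
      (formRad s (Submodule.span F {u, v, w}))
    rw [hd.eq_bot, finrank_bot] at h5
    have h6 := Submodule.finrank_mono (sup_le hle (formRad_le (s := s) (Submodule.span F {u, v, w})))
    omega

/-- Every object is incident with the point spanned by one of its vectors. -/
theorem exists_point_inc (hs : s.IsAlt) {U : Submodule F V} (hU : IsQCTPObject s U) :
    ∃ v ∈ U, v ∉ formRad s ⊤ ∧ ((F ∙ v) = U ∨ ∃ x ∈ U, s v x ≠ 0) := by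
  have hne : U ≠ ⊥ := fun h => by
    have := hU.1
    rw [h, finrank_bot] at this
    omega
  by_cases h : U ≤ formRad s U
  · obtain ⟨v, hv, hv0⟩ := Submodule.exists_mem_ne_zero_of_ne_bot hne
    have h1 : finrank F U = 1 := le_antisymm ((Submodule.finrank_mono h).trans hU.2.2.2) hU.1
    refine ⟨v, hv, fun hr => hv0 (Submodule.disjoint_def.mp hU.2.2.1 v hv hr), Or.inl ?_⟩
    exact Submodule.eq_of_le_of_finrank_eq ((Submodule.span_singleton_le_iff_mem _ _).mpr hv)
      (by rw [h1, finrank_span_singleton hv0])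
  · rw [SetLike.not_le_iff_exists] at h
    obtain ⟨x, hx, hxr⟩ := h
    have : ∃ v ∈ U, s v x ≠ 0 := by
      by_contra! hcon
      exact hxr ⟨hx, hcon⟩
    obtain ⟨v, hv, hvx⟩ := this
    exact ⟨x, hx, fun hr => hvx (hr.2 v trivial), Or.inr ⟨v, hv, form_swap_ne_zero hs hvx⟩⟩

/-- Every object is incident with a point. Non-orthogonal points are joined through their hyperbolic
line, and any two points outside Rad(V) have a common non-orthogonal one. -/
theorem quasiCTPGeometry_incConnected (hs : s.IsAlt) (hdim : 4 ≤ finrank F V) :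
    (quasiCTPGeometry s).IncConnected := by
  rintro S hS ⟨X, hX⟩
  have hS' : ∀ U W : Submodule F V, ∀ (hU : IsQCTPObject s U) (hW : IsQCTPObject s W),
      SubspaceInc s U W → (⟨U, hU⟩ : QCTPObject s) ∈ S → (⟨W, hW⟩ : QCTPObject s) ∈ S :=
    fun U W hU hW h hUS => hS _ _ hUS (quasiCTPGeometry_inc.mpr h)
  have hpt : ∀ Y : QCTPObject s, ∃ v, v ∉ formRad s ⊤ ∧ SubspaceInc s (F ∙ v) Y.1 := by
    intro Y
    obtain ⟨v, hv, hvr, h | ⟨x, hx, h⟩⟩ := exists_point_inc hs Y.2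
    · exact ⟨v, hvr, Or.inl h⟩
    · exact ⟨v, hvr, Or.inr (Or.inl (liesIn_span_singleton hv hx (form_swap_ne_zero hs h)))⟩
  have hline : ∀ v w (h : s v w ≠ 0),
      (⟨F ∙ v, isQCTPObject_span_singleton hdim (notMem_formRad_top hs h)⟩ : QCTPObject s) ∈ S →
      (⟨F ∙ w, isQCTPObject_span_singleton hdim
        (notMem_formRad_top hs (form_swap_ne_zero hs h))⟩ : QCTPObject s) ∈ S := by
    intro v w h hv
    have hvL : v ∈ Submodule.span F {v, w} := Submodule.subset_span (by simp)
    have hwL : w ∈ Submodule.span F {v, w} := Submodule.subset_span (by simp)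
    refine hS' _ _ (isQCTPObject_span_pair hs hdim h) _
      (Or.inr (Or.inr (liesIn_span_singleton hwL hvL h))) ?_
    exact hS' _ _ _ _ (Or.inr (Or.inl (liesIn_span_singleton hvL hwL
      (form_swap_ne_zero hs h)))) hv
  refine Set.eq_univ_of_forall fun Y => ?_
  obtain ⟨v, hv, hvX⟩ := hpt X
  obtain ⟨w, hw, hwY⟩ := hpt Y
  refine hS' _ _ (isQCTPObject_span_singleton hdim hw) Y.2 hwY ?_
  obtain ⟨x, hx⟩ := exists_form_ne_zero hs hv
  obtain ⟨y, hy⟩ := exists_form_ne_zero hs hw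
  obtain ⟨r, -, h1, h2⟩ := exists_form_ne_zero_and (W := ⊤) hs ⟨x, trivial, hx⟩ ⟨y, trivial, hy⟩
  exact hline r w h2 (hline v r h1
    (hS' _ _ X.2 (isQCTPObject_span_singleton hdim hv) hvX.symm hX))

namespace IsSubspaceCocycle

variable {H : Type*} [Group H] {c : Submodule F V → Submodule F V → H}

/-- The restriction of a cocycle to the hyperbolic lines. -/
def onLine (_ : IsSubspaceCocycle s c) (v w : V) : H :=
  c (F ∙ v) (Submodule.span F {v, w}) * c (Submodule.span F {v, w}) (F ∙ w)

/-- The hyperbolic line of v and w is nondegenerate, hence incident with U, and the detour through U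
does not change the product. Evaluating all three sides of a triangle in one common object then
gives `onLine_triangle`. -/
theorem onLine_eq (hc : IsSubspaceCocycle s c) (hs : s.IsAlt) (hdim : 4 ≤ finrank F V)
    {U : Submodule F V} (hU : IsQCTPObject s U) {v w : V} (hv : v ∈ U) (hw : w ∈ U)
    (h : s v w ≠ 0) : hc.onLine v w = c (F ∙ v) U * c U (F ∙ w) := by
  have h' := form_swap_ne_zero hs h
  have hL := isQCTPObject_span_pair hs hdim h
  have hV := isQCTPObject_span_singleton hdim (notMem_formRad_top hs h)
  have hW := isQCTPObject_span_singleton hdim (notMem_formRad_top hs h')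
  have hvL : v ∈ Submodule.span F {v, w} := Submodule.subset_span (by simp)
  have hwL : w ∈ Submodule.span F {v, w} := Submodule.subset_span (by simp)
  have hLU : SubspaceInc s (Submodule.span F {v, w}) U := Or.inr (Or.inl
    (liesIn_of_formRad_eq_bot (Submodule.span_le.mpr (by
      rintro x (rfl | rfl) <;> assumption)) (formRad_span_pair hs h).1))
  have e1 := hc _ _ _ hV hL hU (Or.inr (Or.inl (liesIn_span_singleton hvL hwL h'))) hLU
    (Or.inr (Or.inl (liesIn_span_singleton hv hw h')))
  have e2 := hc _ _ _ hU hL hW hLU.symm (Or.inr (Or.inr (liesIn_span_singleton hwL hvL h)))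
    (Or.inr (Or.inr (liesIn_span_singleton hw hv h)))
  rw [← e1, ← e2, mul_assoc, ← mul_assoc (c _ U), hc.symm hL hU hLU, one_mul]
  rfl

theorem onLine_inv (hc : IsSubspaceCocycle s c) (hs : s.IsAlt) (hdim : 4 ≤ finrank F V)
    {v w : V} (h : s v w ≠ 0) : hc.onLine v w * hc.onLine w v = 1 := by
  have h' := form_swap_ne_zero hs h
  have hL := isQCTPObject_span_pair hs hdim h
  have hV := isQCTPObject_span_singleton hdim (notMem_formRad_top hs h)
  have hW := isQCTPObject_span_singleton hdim (notMem_formRad_top hs h')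
  have hvL : v ∈ Submodule.span F {v, w} := Submodule.subset_span (by simp)
  have hwL : w ∈ Submodule.span F {v, w} := Submodule.subset_span (by simp)
  have i1 : SubspaceInc s (F ∙ v) (Submodule.span F {v, w}) :=
    Or.inr (Or.inl (liesIn_span_singleton hvL hwL h'))
  have i2 : SubspaceInc s (F ∙ w) (Submodule.span F {v, w}) :=
    Or.inr (Or.inl (liesIn_span_singleton hwL hvL h))
  rw [hc.onLine_eq hs hdim hL hvL hwL h, hc.onLine_eq hs hdim hL hwL hvL h', mul_assoc,
    ← mul_assoc (c _ (F ∙ w)), hc.symm hL hW i2.symm, one_mul, hc.symm hV hL i1]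

theorem onLine_smul (hc : IsSubspaceCocycle s c) (hs : s.IsAlt) (hdim : 4 ≤ finrank F V)
    {v w : V} (a b : F) (h : s v w ≠ 0) (ha : a ≠ 0) (hb : b ≠ 0) :
    hc.onLine (a • v) (b • w) = hc.onLine v w := by
  rw [hc.onLine_eq hs hdim (isQCTPObject_span_pair hs hdim h)
    (Submodule.smul_mem _ a (Submodule.subset_span (by simp)))
    (Submodule.smul_mem _ b (Submodule.subset_span (by simp))) (by simp [ha, hb, h]),
    Submodule.span_singleton_smul_eq (IsUnit.mk0 a ha),
    Submodule.span_singleton_smul_eq (IsUnit.mk0 b hb)]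
  rfl

theorem onLine_triangle (hc : IsSubspaceCocycle s c) (hs : s.IsAlt) (hdim : 4 ≤ finrank F V)
    {u v w : V} (huv : s u v ≠ 0) (hvw : s v w ≠ 0) (huw : s u w ≠ 0)
    (hav : SpanAvoidsRad s u v w) :
    hc.onLine u v * hc.onLine v w = hc.onLine u w := by
  have hU := isQCTPObject_span_triple hs hdim huv hav
  have hu : u ∈ Submodule.span F {u, v, w} := Submodule.subset_span (by simp)
  have hv : v ∈ Submodule.span F {u, v, w} := Submodule.subset_span (by simp)
  have hw : w ∈ Submodule.span F {u, v, w} := Submodule.subset_span (by simp)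
  rw [hc.onLine_eq hs hdim hU hu hv huv, hc.onLine_eq hs hdim hU hv hw hvw,
    hc.onLine_eq hs hdim hU hu hw huw, mul_assoc, ← mul_assoc (c _ (F ∙ v)),
    hc.symm hU (isQCTPObject_span_singleton hdim (notMem_formRad_top hs hvw))
      (Or.inr (Or.inr (liesIn_span_singleton hv hu huv))), one_mul]

theorem exists_coboundary (hc : IsSubspaceCocycle s c) (hs : s.IsAlt)
    (hrad : finrank F (formRad s ⊤) ≤ 1) (hdim : 4 ≤ finrank F V)
    (hexc : ¬ (finrank F V = 5 ∧ Nat.card F = 2)) :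
    ∃ f : Submodule F V → H, ∀ X Y, IsQCTPObject s X → IsQCTPObject s Y → SubspaceInc s X Y →
      c X Y = (f X)⁻¹ * f Y := by
  classical
  obtain ⟨f, hf⟩ := exists_potential hs (fun v w h => hc.onLine_inv hs hdim h)
    (triangle_of_spanAvoidsRad hs hrad hdim hexc (fun v w h => hc.onLine_inv hs hdim h)
      (fun v w a b h ha hb => hc.onLine_smul hs hdim a b h ha hb)
      (fun u v w huv hvw huw hav => hc.onLine_triangle hs hdim huv hvw huw hav))
  have hsmul : ∀ v, v ∉ formRad s ⊤ → ∀ a : F, a ≠ 0 → f (a • v) = f v := by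
    intro v hv a ha
    obtain ⟨r, hr⟩ := exists_form_ne_zero hs hv
    have h1 := hf (a • v) ((1 : F) • r) (by simp [ha, hr])
    rw [hc.onLine_smul hs hdim a 1 hr ha one_ne_zero, one_smul, ← hf v r hr] at h1
    exact mul_right_cancel h1
  -- The potential at `U` is carried over from any point incident with `U`. By `hind` the point does
  -- not matter: two such vectors have a common non-orthogonal vector inside `U`, and `onLine_eq`
  -- evaluates both lines in `U`.
  let g : Submodule F V → H := fun U => if h : IsQCTPObject s U then
    f (exists_point_inc hs h).choose * c (F ∙ (exists_point_inc hs h).choose) U else 1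
  have hinc : ∀ (U : Submodule F V) v, v ∈ U → ((F ∙ v) = U ∨ ∃ x ∈ U, s v x ≠ 0) →
      SubspaceInc s (F ∙ v) U := by
    rintro U v hv (h | ⟨x, hx, h⟩)
    · exact Or.inl h
    · exact Or.inr (Or.inl (liesIn_span_singleton hv hx (form_swap_ne_zero hs h)))
  have hind : ∀ U, IsQCTPObject s U → ∀ v w, v ∈ U → v ∉ formRad s ⊤ →
      ((F ∙ v) = U ∨ ∃ x ∈ U, s v x ≠ 0) → w ∈ U → w ∉ formRad s ⊤ →
      ((F ∙ w) = U ∨ ∃ x ∈ U, s w x ≠ 0) →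
      f v * c (F ∙ v) U = f w * c (F ∙ w) U := by
    have hone : ∀ U : Submodule F V, ∀ v ∈ U, (F ∙ v) = U → ¬ ∃ w ∈ U, ∃ x ∈ U, s w x ≠ 0 := by
      rintro U v hv rfl ⟨w, hw, x, hx, h⟩
      obtain ⟨a, rfl⟩ := Submodule.mem_span_singleton.mp hw
      obtain ⟨b, rfl⟩ := Submodule.mem_span_singleton.mp hx
      simp [hs v] at h
    intro U hU v w hv hvr hv' hw hwr hw'
    rcases hv' with hv' | hv'
    · rcases hw' with hw' | hw'
      · rw [hv', hw']
        rw [← hv'] at hw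
        obtain ⟨a, rfl⟩ := Submodule.mem_span_singleton.mp hw
        rw [hsmul v hvr a (by rintro rfl; simp at hwr)]
      · exact absurd ⟨w, hw, hw'⟩ (hone U v hv hv')
    · rcases hw' with hw' | hw'
      · exact absurd ⟨v, hv, hv'⟩ (hone U w hw hw')
      · obtain ⟨r, hr, h1, h2⟩ := exists_form_ne_zero_and hs hv' hw'
        have h2 := form_swap_ne_zero hs h2
        have e1 := hf v r h1
        rw [← hf w r h2, hc.onLine_eq hs hdim hU hv hr h1, hc.onLine_eq hs hdim hU hw hr h2,
          ← mul_assoc, ← mul_assoc] at e1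
        exact mul_right_cancel e1
  have hg : ∀ U (_ : IsQCTPObject s U) v, v ∈ U → v ∉ formRad s ⊤ →
      ((F ∙ v) = U ∨ ∃ x ∈ U, s v x ≠ 0) → g U = f v * c (F ∙ v) U := by
    intro U hU v hv hvr hv'
    simp only [g, dif_pos hU]
    obtain ⟨k1, k2, k3⟩ := (exists_point_inc hs hU).choose_spec
    exact hind U hU _ v k1 k2 k3 hv hvr hv'
  have hmain : ∀ X Y, IsQCTPObject s X → IsQCTPObject s Y → liesIn s X Y →
      g X * c X Y = g Y := by
    intro X Y hX hY h
    obtain ⟨v, hv, hvr, hv'⟩ := exists_point_inc hs hX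
    have hvY : ∃ x ∈ Y, s v x ≠ 0 := by
      by_contra! hcon
      have : v = 0 := Submodule.disjoint_def.mp h.2 v hv
        ⟨h.1 hv, fun y hy => form_swap_eq_zero hs (hcon y hy)⟩
      exact hvr (by rw [this]; exact zero_mem _)
    -- The point of `v` is incident with both `X` and `Y`, so both potentials are computed from `v`
    -- and the cocycle identity finishes.
    rw [hg X hX v hv hvr hv', hg Y hY v (h.1 hv) hvr (Or.inr hvY), mul_assoc,
      hc _ _ _ (isQCTPObject_span_singleton hdim hvr) hX hY (hinc X v hv hv') (Or.inr (Or.inl h))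
        (hinc Y v (h.1 hv) (Or.inr hvY))]
  refine ⟨g, ?_⟩
  rintro X Y hX hY h
  rw [eq_inv_mul_iff_mul_eq]
  rcases h with rfl | h | h
  · rw [hc.self hX, mul_one]
  · exact hmain X Y hX hY h
  · rw [← hmain Y X hY hX h, mul_assoc, hc.symm hY hX (Or.inr (Or.inl h)), mul_one]

end IsSubspaceCocycle

theorem quasiCTPGeometry_cocyclesTrivial (hs : s.IsAlt)
    (hrad : finrank F (formRad s ⊤) ≤ 1) (hdim : 4 ≤ finrank F V)
    (hexc : ¬ (finrank F V = 5 ∧ Nat.card F = 2)) (H : Type*) [Group H] :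
    (quasiCTPGeometry s).CocyclesTrivial H := by
  classical
  intro c hc
  -- The extension by 1 to pairs not consisting of objects makes the cocycle a function of plain
  -- subspaces.
  let c' : Submodule F V → Submodule F V → H := fun X Y =>
    if h : IsQCTPObject s X ∧ IsQCTPObject s Y then c ⟨X, h.1⟩ ⟨Y, h.2⟩ else 1
  have hc' : ∀ X Y (hX : IsQCTPObject s X) (hY : IsQCTPObject s Y),
      c' X Y = c ⟨X, hX⟩ ⟨Y, hY⟩ := fun X Y hX hY => dif_pos ⟨hX, hY⟩
  have hcoc : IsSubspaceCocycle s c' := by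
    intro X Y Z hX hY hZ h1 h2 h3
    rw [hc' X Y hX hY, hc' Y Z hY hZ, hc' X Z hX hZ]
    exact hc _ _ _ (quasiCTPGeometry_inc.mpr h1) (quasiCTPGeometry_inc.mpr h2)
      (quasiCTPGeometry_inc.mpr h3)
  obtain ⟨f, hf⟩ := hcoc.exists_coboundary hs hrad hdim hexc
  refine ⟨fun X => f X.1, fun X Y h => ?_⟩
  rw [← hf X.1 Y.1 X.2 Y.2 (quasiCTPGeometry_inc.mp h), hc' X.1 Y.1 X.2 Y.2]
  rfl

end Symplectic

theorem mainTheorem3 {F : Type u} {V : Type v} [Field F] [AddCommGroup V] [Module F V]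
    [FiniteDimensional F V] (s : LinearMap.BilinForm F V) (hs : s.IsAlt)
    (hrad : Module.finrank F (formRad s ⊤) ≤ 1)
    (hdim : 4 ≤ Module.finrank F V)
    (hexc : ¬ (Module.finrank F V = 5 ∧ Nat.card F = 2)) :
    (quasiCTPGeometry s).IsGeometry ∧
    (quasiCTPGeometry s).ActsFlagTransitively (SpGroup s) ∧
    ∀ C : Set (QCTPObject s), (quasiCTPGeometry s).IsChamber C →
      (quasiCTPGeometry s).IsCompletionOfMaximalParabolics (SpGroup s)
        (quasiCTPGeometry_actsByAutomorphisms s) C := by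
  have hgeo := quasiCTPGeometry_isGeometry hs hrad
  have hft := (quasiCTPGeometry s).actsFlagTransitively_of_chambers (SpGroup s) hgeo
    (quasiCTPGeometry_actsByAutomorphisms s)
    (exists_map_eq_of_isChamber hs (by omega))
  have : Nonempty (Set.Ico 1 (finrank F V)) := ⟨⟨1, le_rfl, by omega⟩⟩
  exact ⟨hgeo, hft, fun C hC => (quasiCTPGeometry s).isCompletion_of_cocyclesTrivial (SpGroup s)
    hft _ C hC (quasiCTPGeometry_incConnected hs hdim)
    (quasiCTPGeometry_cocyclesTrivial hs hrad hdim hexc _)⟩
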